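/- A linking pairing is a symmetric bilinear form $\lambda\colon G\times G\to\mathbb{Q}/\mathbb{Z}$ on a finite abelian group $G$ whose adjoint $G\to\mathrm{Hom}(G,\mathbb{Q}/\mathbb{Z})$ is bijective. The orthogonal sum of $(G,\lambda)$ and $(G',\lambda')$ is the pairing $(\lambda\oplus\lambda')((x,x'),(y,y'))=\lambda(x,y)+\lambda'(x',y')$ on $G\times G'$. An isomorphism of linking pairings is a group isomorphism that preserves the pairings. One says that $\lambda'$ is an orthogonal summand of $\lambda$ if there is a linking pairing $\lambda''$ with $\lambda\cong\lambda'\oplus\lambda''$. Let $(G,\lambda)$ be a linking pairing on a finite abelian $2$-group and let $k\ge 1$. Let $\rho_k(\lambda)$ be the number of summands $\mathbb{Z}/2^k$ in a decomposition of $G$ into cyclic groups. Put $$\Gamma_k(\lambda)=\sum_{x\in G}\exp\bigl(\sqrt{-1}\,\pi\,2^k\lambda(x,x)\bigr).$$ Let $\overline{\mathbb{Z}}_8=\mathbb{Z}/8\cup\{\infty\}$, with $\infty+u=u+\infty=\infty$ for all $u$. If $\Gamma_k(\lambda)=0$, put $\sigma_k(\lambda)=\infty$. Otherwise $\Gamma_k(\lambda)/|\Gamma_k(\lambda)|$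 is an eighth root of unity, and $\sigma_k(\lambda)=n\in\mathbb{Z}/8$ is the class such that $\Gamma_k(\lambda)/|\Gamma_k(\lambda)|=\exp(2\pi\sqrt{-1}\,n/8)$. A tableau is a map $T\colon\mathbb{N}_{\ge1}\to\mathbb{N}\times\overline{\mathbb{Z}}_8$. It is admissible if there is a linking pairing $\mu$ on a finite abelian $2$-group with $T(m)=(\rho_m(\mu),\sigma_m(\mu))$ for all $m\ge1$. **Theorem.** Let $\lambda$ and $\lambda'$ be linking pairings on finite abelian $2$-groups. Then $\lambda'$ is an orthogonal summand of $\lambda$ if and only if the following three conditions hold: 1. $\rho_k(\lambda)\ge\rho_k(\lambda')$ for all $k\ge1$; 2. for all $k\ge1$, if $\sigma_k(\lambda')=\infty$ then $\sigma_k(\lambda)=\infty$; 3. some tableau in $S_{\lambda,\lambda'}$ is admissible. Here $S_{\lambda,\lambda'}$ is the family of the tableaux $T_a=(r_a,s_a)$, where $a$ runs over all maps from $\{k\ge1 : \sigma_k(\lambda')=\infty\}$ to $\overline{\mathbb{Z}}_8$, and $$r_a(k)=\rho_k(\lambda)-\rho_k(\lambda'),\qquad s_a(k)=\begin{cases}a(k)&\text{if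 }\sigma_k(\lambda')=\infty,\\ \sigma_k(\lambda)-\sigma_k(\lambda')&\text{if }\sigma_k(\lambda')\neq\infty.\end{cases}$$ -/

import Mathlib

/-- A linking pairing on a finite abelian group `G`: a symmetric biadditive map
`G × G → ℚ/ℤ` whose adjoint `G → Hom(G, ℚ/ℤ)` is bijective. -/
structure LinkingPairing (G : Type*) [AddCommGroup G] where
  /-- the adjoint homomorphism, so that the pairing is `(x, y) ↦ form x y` -/
  form : G →+ G →+ AddCircle (1 : ℚ)
  symm : ∀ x y, form x y = form y x
  bijective_adjoint : Function.Bijective form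

namespace LinkingPairing

/-- Isomorphism of linking pairings. -/
def Isomorphic {G H : Type*} [AddCommGroup G] [AddCommGroup H]
    (a : LinkingPairing G) (b : LinkingPairing H) : Prop :=
  ∃ e : G ≃+ H, ∀ x y, b.form (e x) (e y) = a.form x y

/-- The orthogonal sum:
`(a ⊕ b) ((x, x'), (y, y')) = a (x, y) + b (x', y')`. -/
def orthogonalSum {G H : Type*} [AddCommGroup G] [AddCommGroup H]
    (a : LinkingPairing G) (b : LinkingPairing H) : LinkingPairing (G × H) where
  form := AddMonoidHom.mk' (fun z => (a.form z.1).coprod (b.form z.2)) (by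
    intro z w
    ext x
    simp only [map_add, AddMonoidHom.coprod_apply, AddMonoidHom.add_apply, Prod.fst_add,
      Prod.snd_add]
    abel)
  symm x y := by simp [a.symm x.1 y.1, b.symm x.2 y.2]
  bijective_adjoint := by
    constructor
    · rw [injective_iff_map_eq_zero]
      intro z hz
      have h1 : a.form z.1 = 0 := by
        ext x
        simpa using DFunLike.congr_fun hz (x, 0)
      have h2 : b.form z.2 = 0 := by
        ext x
        simpa using DFunLike.congr_fun hz (0, x)
      exact Prod.ext ((injective_iff_map_eq_zero _).1 a.bijective_adjoint.1 _ h1)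
        ((injective_iff_map_eq_zero _).1 b.bijective_adjoint.1 _ h2)
    · intro f
      obtain ⟨x, hx⟩ := a.bijective_adjoint.2 (f.comp (AddMonoidHom.inl G H))
      obtain ⟨y, hy⟩ := b.bijective_adjoint.2 (f.comp (AddMonoidHom.inr G H))
      refine ⟨(x, y), ?_⟩
      ext z
      simp [hx, hy, -map_add]

@[simp]
theorem orthogonalSum_form {G H : Type*} [AddCommGroup G] [AddCommGroup H]
    (a : LinkingPairing G) (b : LinkingPairing H) (z w : G × H) :
    (a.orthogonalSum b).form z w = a.form z.1 w.1 + b.form z.2 w.2 := rfl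

/-- `b` is an orthogonal summand of `a`: there is a linking pairing `c` on a finite abelian
group with `a ≅ b ⊕ c`.  (A finite group has an isomorphic copy in `Type`, so that letting the
group of `c` range over `Type` is no restriction.) -/
def IsOrthogonalSummand {G H : Type*} [AddCommGroup G] [AddCommGroup H]
    (b : LinkingPairing H) (a : LinkingPairing G) : Prop :=
  ∃ (K : Type) (_ : AddCommGroup K) (_ : Fintype K) (c : LinkingPairing K),
    a.Isomorphic (b.orthogonalSum c)

end LinkingPairing

/-- The number of cyclic summands of order at least `2 ^ (j + 1)` in a finite abelian `2`-group:
the dimension over `𝔽₂` of `2 ^ j G / 2 ^ (j + 1) G`. -/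
noncomputable def twoLayerRank (G : Type*) [AddCommGroup G] (j : ℕ) : ℕ :=
  Nat.log 2 ((nsmulAddMonoidHom (α := G) (2 ^ (j + 1))).range.relIndex
    (nsmulAddMonoidHom (α := G) (2 ^ j)).range)

/-- The rank over `ℤ/2^k` of the free `ℤ/2^k`-module `G_k` in a decomposition `G = ⨁ G_k` of a
finite abelian `2`-group; see `homogeneousRank_eq_card`. -/
noncomputable def homogeneousRank (G : Type*) [AddCommGroup G] (k : ℕ+) : ℕ :=
  twoLayerRank G ((k : ℕ) - 1) - twoLayerRank G k

theorem card_range_nsmul_pi {G ι : Type*} [AddCommGroup G] [Fintype ι] (e : ι → ℕ)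
    (f : G ≃+ ((i : ι) → ZMod (2 ^ e i))) (j : ℕ) :
    Nat.card (nsmulAddMonoidHom (α := G) (2 ^ j)).range = 2 ^ ∑ i, (e i - j) := by
  have h1 : ∀ i, Nat.card (nsmulAddMonoidHom (α := ZMod (2 ^ e i)) (2 ^ j)).range
      = 2 ^ (e i - j) := by
    intro i
    have : (nsmulAddMonoidHom (α := ZMod (2 ^ e i)) (2 ^ j)).range
        = AddSubgroup.zmultiples (((2 ^ j : ℕ) : ZMod (2 ^ e i))) := by
      ext x
      simp only [AddMonoidHom.mem_range, AddSubgroup.mem_zmultiples_iff,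
        nsmulAddMonoidHom_apply]
      constructor
      · rintro ⟨y, rfl⟩
        obtain ⟨n, rfl⟩ := ZMod.intCast_surjective y
        exact ⟨n, by simp [mul_comm]⟩
      · rintro ⟨n, rfl⟩
        exact ⟨n, by simp [mul_comm]⟩
    rw [this, Nat.card_zmultiples, ZMod.addOrderOf_coe _ (by positivity)]
    rcases le_total (e i) j with h | h
    · rw [Nat.gcd_eq_left (pow_dvd_pow 2 h), Nat.div_self (by positivity),
        Nat.sub_eq_zero_of_le h, pow_zero]
    · rw [Nat.gcd_eq_right (pow_dvd_pow 2 h), Nat.pow_div h (by norm_num)]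
  rw [← Finset.prod_pow_eq_pow_sum, ← Finset.prod_congr rfl (fun i _ => h1 i), ← Nat.card_pi]
  refine Nat.card_congr ((f.toEquiv.subtypeEquiv
    (q := fun z => ∀ i, z i ∈ (nsmulAddMonoidHom (α := ZMod (2 ^ e i)) (2 ^ j)).range) ?_).trans
    (Equiv.subtypePiEquivPi (p := fun i z =>
      z ∈ (nsmulAddMonoidHom (α := ZMod (2 ^ e i)) (2 ^ j)).range)))
  intro x
  simp only [AddMonoidHom.mem_range, nsmulAddMonoidHom_apply]
  constructor
  · rintro ⟨y, rfl⟩ i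
    exact ⟨f y i, by simp⟩
  · intro h
    choose y hy using h
    refine ⟨f.symm y, f.injective ?_⟩
    ext i
    simpa using hy i

theorem twoLayerRank_eq_card {G ι : Type*} [AddCommGroup G] [Fintype ι] (e : ι → ℕ)
    (f : G ≃+ ((i : ι) → ZMod (2 ^ e i))) (j : ℕ) :
    twoLayerRank G j = (Finset.univ.filter fun i => j < e i).card := by
  have hle : (nsmulAddMonoidHom (α := G) (2 ^ (j + 1))).range ≤
      (nsmulAddMonoidHom (α := G) (2 ^ j)).range := by
    rintro _ ⟨y, rfl⟩
    exact ⟨2 • y, by simp [pow_succ, mul_smul]⟩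
  have h := AddSubgroup.relIndex_mul_relIndex ⊥ _ _ bot_le hle
  rw [AddSubgroup.relIndex_bot_left, AddSubgroup.relIndex_bot_left, mul_comm] at h
  rw [card_range_nsmul_pi e f, card_range_nsmul_pi e f] at h
  have hs : ∑ i, (e i - j) = (Finset.univ.filter fun i => j < e i).card +
      ∑ i, (e i - (j + 1)) := by
    rw [Finset.card_filter, ← Finset.sum_add_distrib]
    refine Finset.sum_congr rfl fun i _ => ?_
    split_ifs <;> omega
  rw [hs, pow_add 2 (Finset.card _)] at h
  have h' := Nat.eq_of_mul_eq_mul_right (Nat.two_pow_pos _) h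
  rw [twoLayerRank, h', Nat.log_pow (by norm_num)]

/-- In any decomposition of a `2`-group into cyclic groups, `homogeneousRank G k` is the number
of summands `ℤ/2^k`. -/
theorem homogeneousRank_eq_card {G ι : Type*} [AddCommGroup G] [Fintype ι] (e : ι → ℕ)
    (f : G ≃+ ((i : ι) → ZMod (2 ^ e i))) (k : ℕ+) :
    homogeneousRank G k = (Finset.univ.filter fun i => e i = k).card := by
  rw [homogeneousRank, twoLayerRank_eq_card e f, twoLayerRank_eq_card e f, Finset.card_filter,
    Finset.card_filter, Finset.card_filter, Nat.sub_eq_iff_eq_add, ← Finset.sum_add_distrib]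
  · have := k.pos
    refine Finset.sum_congr rfl fun i _ => ?_
    split_ifs <;> omega
  · refine Finset.sum_le_sum fun i _ => ?_
    split_ifs <;> omega

/-- For `k ≥ 1`, the map `ℚ/ℤ → ℂ`, `t ↦ exp (√-1 π 2^k t)`. -/
noncomputable def gaussTerm (k : ℕ+) : AddCircle (1 : ℚ) → ℂ :=
  Function.Periodic.lift
    (f := fun t : ℚ => Complex.exp (Complex.I * Real.pi * 2 ^ (k : ℕ) * t)) (by
      intro t
      obtain ⟨n, hn⟩ := Nat.exists_eq_add_of_lt k.pos
      have : Complex.I * Real.pi * 2 ^ (k : ℕ) * ((t + 1 : ℚ) : ℂ) =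
          Complex.I * Real.pi * 2 ^ (k : ℕ) * t +
            ((2 ^ n : ℕ) : ℂ) * (2 * Real.pi * Complex.I) := by
        rw [hn]
        push_cast
        ring
      simp only [this]
      rw [Complex.exp_add, Complex.exp_nat_mul_two_pi_mul_I, mul_one])

theorem gaussTerm_coe (k : ℕ+) (t : ℚ) :
    gaussTerm k (t : AddCircle (1 : ℚ)) =
      Complex.exp (Complex.I * Real.pi * 2 ^ (k : ℕ) * t) := rfl

/-- The monoid `ℤ/8 ∪ {∞}`, with `∞ + a = a + ∞ = ∞`; the element `∞` is `⊤`. -/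
abbrev ExtendedZMod8 := WithTop (ZMod 8)

open Classical in
/-- For a complex number `z` that is zero or has `z / |z|` an eighth root of unity: `∞` if
`z = 0`, and otherwise `Arg z / 2π` read in `(1/8)ℤ/ℤ = ℤ/8`, that is, the class `n` with
`z / |z| = exp (2 π √-1 n / 8)`; see `eighthPhase_eq`. -/
noncomputable def eighthPhase (z : ℂ) : ExtendedZMod8 :=
  if z = 0 then ⊤ else (((round (8 * (z.arg / (2 * Real.pi))) : ℤ) : ZMod 8) : ExtendedZMod8)

theorem eighthPhase_eq (r : ℝ) (hr : 0 < r) (n : ℤ) :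
    eighthPhase (r * Complex.exp (2 * Real.pi * Complex.I * (n / 8))) =
      ((n : ZMod 8) : ExtendedZMod8) := by
  have hne : (r : ℂ) * Complex.exp (2 * Real.pi * Complex.I * (n / 8)) ≠ 0 :=
    mul_ne_zero (by exact_mod_cast hr.ne') (Complex.exp_ne_zero _)
  rw [eighthPhase, if_neg hne, Complex.arg_real_mul _ hr]
  have h1 : (2 * Real.pi * Complex.I * (n / 8) : ℂ) =
      ((2 * Real.pi * (n / 8) : ℝ) : ℂ) * Complex.I := by
    push_cast
    ring
  rw [h1, Complex.arg_exp_mul_I, toIocMod]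
  set m := toIocDiv Real.two_pi_pos (-Real.pi) (2 * Real.pi * (n / 8))
  have h2 : 8 * ((2 * Real.pi * (n / 8) - m • (2 * Real.pi)) / (2 * Real.pi)) =
      ((n - 8 * m : ℤ) : ℝ) := by
    have := Real.pi_ne_zero
    push_cast
    rw [zsmul_eq_mul]
    field_simp
  rw [h2, round_intCast]
  have h3 : (8 : ZMod 8) = 0 := by decide
  rw [Int.cast_sub, Int.cast_mul]
  simp [h3]

namespace LinkingPairing

/-- The invariant `ρ_k`. -/
noncomputable def rho {G : Type*} [AddCommGroup G] (_a : LinkingPairing G) (k : ℕ+) : ℕ :=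
  homogeneousRank G k

/-- The Gauss sum `Γ_k = ∑ x, exp (√-1 π 2^k λ(x, x))`. -/
noncomputable def gaussSum {G : Type*} [AddCommGroup G] [Fintype G]
    (a : LinkingPairing G) (k : ℕ+) : ℂ :=
  ∑ x : G, gaussTerm k (a.form x x)

/-- The invariant `σ_k`, with values in `ℤ/8 ∪ {∞}`. -/
noncomputable def sigma {G : Type*} [AddCommGroup G] [Fintype G]
    (a : LinkingPairing G) (k : ℕ+) : ExtendedZMod8 :=
  eighthPhase (a.gaussSum k)

end LinkingPairing

/-- Tableaux `m ↦ (r m, s m)` on the positive integers. -/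
abbrev LinkingTableau := ℕ+ → ℕ × ExtendedZMod8

/-- A tableau is admissible if it is the tableau of the invariants `(ρ_m, σ_m)` of some linking
pairing on a finite abelian `2`-group. -/
def LinkingTableau.IsAdmissible (T : LinkingTableau) : Prop :=
  ∃ (K : Type) (_ : AddCommGroup K) (_ : Fintype K) (c : LinkingPairing K),
    IsPGroup 2 (Multiplicative K) ∧ ∀ m : ℕ+, T m = (c.rho m, c.sigma m)

/-- `u - v` in `ℤ/8 ∪ {∞}` for invertible `v`, that is, for `v` in `ℤ/8`. -/
def ExtendedZMod8.subFinite (u : ExtendedZMod8) (v : ZMod 8) : ExtendedZMod8 :=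
  u + ((-v : ZMod 8) : ExtendedZMod8)

/-- The tableau `T_c` of the pair `(a, b)`, for a map `c` from `{k | σ_k(b) = ∞}` to
`ℤ/8 ∪ {∞}`: its rank entries are `ρ_k(a) - ρ_k(b)`, its signature entries are `c k` where
`σ_k(b) = ∞` and `σ_k(a) - σ_k(b)` elsewhere.  It is meaningful when `ρ_k(b) ≤ ρ_k(a)` for
all `k`. -/
noncomputable def differenceTableau {G H : Type*} [AddCommGroup G] [Fintype G]
    [AddCommGroup H] [Fintype H] (a : LinkingPairing G) (b : LinkingPairing H)
    (c : {k : ℕ+ // b.sigma k = ⊤} → ExtendedZMod8) : LinkingTableau :=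
  open Classical in
  fun k => (a.rho k - b.rho k,
    if h : b.sigma k = ⊤ then c ⟨k, h⟩
    else ExtendedZMod8.subFinite (a.sigma k) ((b.sigma k).untop h))

/-- The family of all difference tableaux of the pair `(a, b)`. -/
def differenceTableaux {G H : Type*} [AddCommGroup G] [Fintype G]
    [AddCommGroup H] [Fintype H] (a : LinkingPairing G) (b : LinkingPairing H) :
    Set LinkingTableau :=
  Set.range (differenceTableau a b)

/-!
The invariants `ρ_k` and `σ_k` are additive under orthogonal sums and, by Kawauchi and Kojima,
classify the linking pairings on finite abelian `2`-groups.  Hence `b` is an orthogonal summand of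
`a` exactly when the equations `ρ_k(a) = ρ_k(b) + ρ_k(c)` and `σ_k(a) = σ_k(b) + σ_k(c)` have a
solution `c`; where `σ_k(b) = ∞` the second one only says that `σ_k(a) = ∞`.

For the classification, let `φ` and `ψ` be pairings on `G` and `H` with the same invariants and list
the elements of `G` as `g_i`.  By Fourier inversion the number of tuples `y_i` in `H` with
`ψ(y_i, y_j) = φ(g_i, g_j)` for all `i`, `j` is a combination of the Gauss sums of the forms
`∑ A_ij ψ(y_i, y_j)` with `A` an integral matrix.  If these agree with the Gauss sums for `φ`, such
a tuple exists, and `g_i ↦ y_i` is an isomorphism.  Modulo a power of `2` every integral quadratic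
form splits into blocks `2 ^ r u x²` with `u` odd, `2 ^ r x y` and `2 ^ r (x² + x y + y²)`.  The
sums of the first kind are Galois conjugate to `Γ_{r + 1}`, and those of the second kind depend only
on the group.  So do those of the third kind: they are real with known square, and the symmetry of
order three of `x² + x y + y²` shows that they are congruent to `1` modulo `3`, which fixes the
sign.
-/

open scoped ComplexConjugate

open Matrix in
/-- `n` divides every value of the quadratic form `x ↦ xᵀ A x`. -/
def FormDvd {ι : Type*} [Fintype ι] (n : ℤ) (A : Matrix ι ι ℤ) : Prop :=
  ∀ x : ι → ℤ, n ∣ x ⬝ᵥ A *ᵥ x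

open Matrix in
/-- Equivalence modulo `n` of the quadratic forms `x ↦ xᵀ A x` and `x ↦ xᵀ B x`: a substitution
that is invertible modulo `n` carries one into the other.  The matrices are not symmetrised, so
that forms with odd cross terms are included. -/
def FormEquiv {ι : Type*} [Fintype ι] [DecidableEq ι] (n : ℤ) (A B : Matrix ι ι ℤ) : Prop :=
  ∃ P : Matrix ι ι ℤ, IsCoprime P.det n ∧ FormDvd n (Pᵀ * A * P - B)

/-- The indecomposable integral quadratic forms over the `2`-adic integers, up to equivalence:
`2 ^ r u x²` with `u` odd, `2 ^ r x y` and `2 ^ r (x² + x y + y²)`. -/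
inductive IsJordanBlock : {m : ℕ} → Matrix (Fin m) (Fin m) ℤ → Prop
  | unary (r : ℕ) {u : ℤ} (hu : Odd u) : IsJordanBlock !![2 ^ r * u]
  | hyperbolic (r : ℕ) : IsJordanBlock ((2 : ℤ) ^ r • !![0, 1; 0, 0])
  | anisotropic (r : ℕ) : IsJordanBlock ((2 : ℤ) ^ r • !![1, 1; 0, 1])

section FormEquiv

open Matrix

variable {ι κ : Type*} [Fintype ι] [Fintype κ] {n : ℤ}

theorem FormDvd.add {A B : Matrix ι ι ℤ} (hA : FormDvd n A) (hB : FormDvd n B) :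
    FormDvd n (A + B) := fun x => by
  rw [add_mulVec, dotProduct_add]
  exact dvd_add (hA x) (hB x)

theorem FormDvd.congr {A : Matrix ι ι ℤ} (hA : FormDvd n A) (P : Matrix ι κ ℤ) :
    FormDvd n (Pᵀ * A * P) := fun x => by
  rw [← mulVec_mulVec, ← mulVec_mulVec, dotProduct_mulVec, vecMul_transpose]
  exact hA _

theorem sum_sum_eq_zero_of_alternating {M : Type*} [AddCommGroup M] {f : ι → ι → M}
    (hdiag : ∀ i, f i i = 0) (hoff : ∀ i j, i ≠ j → f i j + f j i = 0) :
    ∑ i, ∑ j, f i j = 0 := by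
  rw [← Fintype.sum_prod_type']
  refine Finset.sum_involution (fun z _ => z.swap) ?_ ?_ (fun _ _ => Finset.mem_univ _)
    (fun _ _ => Prod.swap_swap _)
  · rintro ⟨i, j⟩ -
    by_cases hij : i = j
    · simp [hij, hdiag]
    · exact hoff i j hij
  · rintro ⟨i, j⟩ - hne heq
    obtain rfl : j = i := congrArg Prod.fst heq
    exact hne (hdiag j)

theorem formDvd_iff {A : Matrix ι ι ℤ} :
    FormDvd n A ↔ (∀ i, n ∣ A i i) ∧ ∀ i j, i ≠ j → n ∣ A i j + A j i := by
  classical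
  constructor
  · intro h
    have hdiag : ∀ i, n ∣ A i i := fun i => by simpa using h (Pi.single i 1)
    refine ⟨hdiag, fun i j _ => ?_⟩
    have hij : n ∣ A i i + A i j + (A j i + A j j) := by
      convert h (Pi.single i 1 + Pi.single j 1) using 1
      simp only [mulVec_add, dotProduct_add, add_dotProduct, single_dotProduct,
        mulVec_single_one, col_apply, one_mul]
      ring
    rw [show A i j + A j i = A i i + A i j + (A j i + A j j) - A i i - A j j by ring]
    exact dvd_sub (dvd_sub hij (hdiag i)) (hdiag j)
  · rintro ⟨hdiag, hoff⟩ x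
    simp only [← Int.natAbs_dvd (a := n), ← CharP.intCast_eq_zero_iff (ZMod n.natAbs)]
      at hdiag hoff ⊢
    simp only [dotProduct, mulVec, Finset.mul_sum, Int.cast_sum, Int.cast_mul]
    refine sum_sum_eq_zero_of_alternating (fun i => ?_) fun i j hij => ?_
    · rw [hdiag, zero_mul, mul_zero]
    · have := hoff i j hij
      push_cast at this
      linear_combination (x i * x j : ZMod n.natAbs) * this

theorem formDvd_fin_two {A : Matrix (Fin 2) (Fin 2) ℤ} (h₀ : n ∣ A 0 0)
    (h₁ : n ∣ A 0 1 + A 1 0) (h₂ : n ∣ A 1 1) : FormDvd n A := by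
  refine formDvd_iff.2 ⟨fun i => ?_, fun i j hij => ?_⟩
  · fin_cases i
    exacts [h₀, h₂]
  · fin_cases i <;> fin_cases j
    exacts [absurd rfl hij, h₁, add_comm (A 0 1) _ ▸ h₁, absurd rfl hij]

theorem formDvd_fromBlocks_zero {B : Matrix ι κ ℤ} {C : Matrix κ ι ℤ}
    (h : ∀ i j, n ∣ B i j + C j i) : FormDvd n (fromBlocks 0 B C 0) := by
  refine formDvd_iff.2 ⟨?_, ?_⟩
  · rintro (_ | _) <;> simp
  · rintro (i | i) (j | j) - <;> simp [h, add_comm (C _ _)]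

theorem FormDvd.fromBlocks_zero {A : Matrix ι ι ℤ} (h : FormDvd n A) :
    FormDvd n (fromBlocks A 0 0 (0 : Matrix κ κ ℤ)) := by
  rw [formDvd_iff] at h
  refine formDvd_iff.2 ⟨?_, ?_⟩
  · rintro (_ | _) <;> simp [h.1]
  · rintro (i | i) (j | j) hij <;> simp_all

variable [DecidableEq ι] [DecidableEq κ]

theorem FormDvd.formEquiv {A B : Matrix ι ι ℤ} (h : FormDvd n (A - B)) : FormEquiv n A B :=
  ⟨1, by simp [isCoprime_one_left], by simpa using h⟩

theorem FormEquiv.trans {A B C : Matrix ι ι ℤ} (hAB : FormEquiv n A B) (hBC : FormEquiv n B C) :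
    FormEquiv n A C := by
  obtain ⟨P, hP, hPA⟩ := hAB
  obtain ⟨Q, hQ, hQB⟩ := hBC
  refine ⟨P * Q, by simpa using hP.mul_left hQ, ?_⟩
  convert (hPA.congr Q).add hQB using 1
  simp only [transpose_mul, Matrix.mul_sub, Matrix.sub_mul, Matrix.mul_assoc]
  abel

theorem FormEquiv.smul {A B : Matrix ι ι ℤ} (h : FormEquiv n A B) (d : ℤ) :
    FormEquiv n (d • A) (d • B) := by
  obtain ⟨P, hP, hPA⟩ := h
  refine ⟨P, hP, fun x => ?_⟩
  rw [Matrix.mul_smul, Matrix.smul_mul, ← smul_sub, smul_mulVec, dotProduct_smul]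
  exact (hPA x).mul_left d

theorem FormEquiv.fromBlocks_left {A A' : Matrix ι ι ℤ} (h : FormEquiv n A A')
    (D : Matrix κ κ ℤ) : FormEquiv n (fromBlocks A 0 0 D) (fromBlocks A' 0 0 D) := by
  obtain ⟨P, hP, hPA⟩ := h
  refine ⟨fromBlocks P 0 0 1, by simpa using hP, ?_⟩
  convert hPA.fromBlocks_zero (κ := κ) using 1
  simp [fromBlocks_transpose, fromBlocks_multiply, sub_eq_add_neg, fromBlocks_neg,
    fromBlocks_add]

/-- Completes the square by the substitution `x ↦ x + L y`. -/
theorem formEquiv_fromBlocks_of_dvd {A : Matrix ι ι ℤ} {B : Matrix ι κ ℤ} {C : Matrix κ ι ℤ}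
    {L : Matrix ι κ ℤ} (D : Matrix κ κ ℤ) (h : ∀ i j, n ∣ ((A + Aᵀ) * L + B + Cᵀ) i j) :
    FormEquiv n (fromBlocks A B C D) (fromBlocks A 0 0 (Lᵀ * A * L + Lᵀ * B + C * L + D)) := by
  refine ⟨fromBlocks 1 L 0 1, by simp [isCoprime_one_left], ?_⟩
  convert formDvd_fromBlocks_zero (B := A * L + B) (C := Lᵀ * A + C) (fun i j => ?_) using 1
  · simp [fromBlocks_transpose, fromBlocks_multiply, sub_eq_add_neg, fromBlocks_neg,
      fromBlocks_add, Matrix.add_mul]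
    abel
  · convert h i j using 1
    have : (Lᵀ * A) j i = (Aᵀ * L) i j := by
      rw [← transpose_apply (Aᵀ * L), transpose_mul, transpose_transpose]
    simp only [Matrix.add_mul, Matrix.add_apply, this, transpose_apply]
    ring

theorem exists_formEquiv_fromBlocks {A S : Matrix ι ι ℤ} {B : Matrix ι κ ℤ} {C : Matrix κ ι ℤ}
    {d : ℤ} (D : Matrix κ κ ℤ) (hA : A + Aᵀ = d • S) (hS : IsCoprime S.det n)
    (hBC : ∀ i j, d ∣ B i j + C j i) :
    ∃ D', FormEquiv n (fromBlocks A B C D) (fromBlocks A 0 0 D') := by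
  obtain ⟨w, z, hw⟩ := hS
  choose M hM using hBC
  have hBC : B + Cᵀ = d • of M := by
    ext i j
    simpa using hM i j
  refine ⟨_, formEquiv_fromBlocks_of_dvd (L := -w • (S.adjugate * of M)) D fun i j => ?_⟩
  have hsq : (A + Aᵀ) * (-w • (S.adjugate * of M)) + B + Cᵀ = n • (z * d) • of M := by
    rw [add_assoc, hBC, hA, Matrix.smul_mul, Matrix.mul_smul, ← Matrix.mul_assoc,
      mul_adjugate, Matrix.smul_mul, Matrix.one_mul, smul_smul, smul_smul, smul_smul, ← add_smul]
    congr 1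
    linear_combination d * (-hw)
  rw [hsq]
  exact Dvd.intro _ rfl

theorem exists_formEquiv_submatrix_fromBlocks {A : Matrix ι ι ℤ} {m : ℕ} {f : Fin m → ι}
    (hf : Function.Injective f) {d : ℤ} {S : Matrix (Fin m) (Fin m) ℤ}
    (hA : A.submatrix f f + (A.submatrix f f)ᵀ = d • S) (hS : IsCoprime S.det n)
    (hoff : ∀ i j, i ≠ j → d ∣ A i j + A j i) :
    ∃ (e : Fin m ⊕ ((Set.range f)ᶜ : Set ι) ≃ ι) (D : Matrix _ _ ℤ),
      FormEquiv n (A.submatrix e e) (fromBlocks (A.submatrix f f) 0 0 D) := by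
  classical
  let e : Fin m ⊕ ((Set.range f)ᶜ : Set ι) ≃ ι :=
    ((Equiv.ofInjective f hf).sumCongr (Equiv.refl _)).trans (Equiv.Set.sumCompl (Set.range f))
  have he : (A.submatrix e e).toBlocks₁₁ = A.submatrix f f := by
    ext i j
    simp [toBlocks₁₁, e]
  obtain ⟨D, hD⟩ := exists_formEquiv_fromBlocks (A := A.submatrix f f)
    (B := (A.submatrix e e).toBlocks₁₂) (C := (A.submatrix e e).toBlocks₂₁)
    (A.submatrix e e).toBlocks₂₂ hA hS fun i j =>
      hoff _ _ (e.injective.ne Sum.inl_ne_inr)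
  refine ⟨e, D, ?_⟩
  rwa [← he, fromBlocks_toBlocks, he] at hD

end FormEquiv

section Binary

open Matrix

theorem formEquiv_fin_two_of_subst {n a b c a' b' c' : ℤ} (p q r s : ℤ)
    (hdet : IsCoprime (p * s - q * r) n) (h₀ : n ∣ a * p ^ 2 + b * p * r + c * r ^ 2 - a')
    (h₁ : n ∣ 2 * a * p * q + b * (p * s + q * r) + 2 * c * r * s - b')
    (h₂ : n ∣ a * q ^ 2 + b * q * s + c * s ^ 2 - c') :
    FormEquiv n !![a, b; 0, c] !![a', b'; 0, c'] := by
  refine ⟨!![p, q; r, s], by simpa [det_fin_two] using hdet, formDvd_fin_two ?_ ?_ ?_⟩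
  · convert h₀ using 1
    simp [mul_apply, Fin.sum_univ_two]
    ring
  · convert h₁ using 1
    simp [mul_apply, Fin.sum_univ_two]
    ring
  · convert h₂ using 1
    simp [mul_apply, Fin.sum_univ_two]
    ring

theorem isCoprime_two_pow_of_odd {u : ℤ} (hu : Odd u) (N : ℕ) : IsCoprime u (2 ^ N) :=
  (Int.isCoprime_two_right.2 hu).pow_right

theorem exists_two_pow_dvd_quadratic {B C : ℤ} (A : ℤ) (hB : Odd B) (hC : Even C) (N : ℕ) :
    ∃ t : ℤ, 2 ^ N ∣ A * t ^ 2 + B * t + C := by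
  suffices h : ∃ t : ℤ, 2 ^ (N + 1) ∣ A * t ^ 2 + B * t + C from
    h.imp fun _ => (pow_dvd_pow 2 N.le_succ).trans
  induction N with
  | zero => exact ⟨0, by simpa [even_iff_two_dvd] using hC⟩
  | succ N ih =>
    obtain ⟨t, w, hw⟩ := ih
    obtain ⟨v, hv⟩ : 2 ∣ w * (2 * A * t + B + 1) + 2 ^ (N + 1) * A * w ^ 2 := by
      have : Even (2 * A * t + B + 1) := by grind
      exact dvd_add (this.two_dvd.mul_left w) ⟨2 ^ N * A * w ^ 2, by ring⟩
    exact ⟨t + 2 ^ (N + 1) * w, v, by linear_combination hw + 2 ^ (N + 1) * hv⟩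

theorem formEquiv_hyperbolic_of_even_right {a b c : ℤ} (hb : Odd b) (hc : Even c) (N : ℕ) :
    FormEquiv (2 ^ N) !![a, b; 0, c] !![0, 1; 0, 0] := by
  obtain ⟨t, ht⟩ := exists_two_pow_dvd_quadratic a hb hc N
  have hb' : Odd (2 * a * t + b) := by grind
  obtain ⟨w, z, hw⟩ := isCoprime_two_pow_of_odd hb' N
  have hroot : FormEquiv (2 ^ N) !![a, b; 0, c] !![a, 2 * a * t + b; 0, 0] :=
    formEquiv_fin_two_of_subst 1 t 0 1 (by simp [isCoprime_one_left]) (by simp)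
      (by ring_nf; simp) (by convert ht using 1; ring)
  refine hroot.trans (formEquiv_fin_two_of_subst 1 0 (-(a * w)) w ?_ ?_ ?_ (by simp))
  · exact ⟨2 * a * t + b, z, by linear_combination hw⟩
  · exact ⟨a * z, by linear_combination -a * hw⟩
  · exact ⟨-z, by linear_combination hw⟩

theorem formEquiv_hyperbolic {a b c : ℤ} (hb : Odd b) (hac : Even a ∨ Even c) (N : ℕ) :
    FormEquiv (2 ^ N) !![a, b; 0, c] !![0, 1; 0, 0] := by
  refine hac.elim (fun ha => ?_) fun hc => formEquiv_hyperbolic_of_even_right hb hc N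
  have hswap : FormEquiv (2 ^ N) !![a, b; 0, c] !![c, b; 0, a] :=
    formEquiv_fin_two_of_subst 0 1 1 0 (by simp [isCoprime_one_left.neg_left]) (by simp)
      (by simp) (by simp)
  exact hswap.trans (formEquiv_hyperbolic_of_even_right hb ha N)

theorem formEquiv_anisotropic {a b c : ℤ} (ha : Odd a) (hb : Odd b) (hc : Odd c) (N : ℕ) :
    FormEquiv (2 ^ N) !![a, b; 0, c] !![1, 1; 0, 1] := by
  obtain ⟨t, ht⟩ := exists_two_pow_dvd_quadratic a hb (hc.sub_odd odd_one) N
  obtain ⟨k, hk⟩ : Odd (2 * a * t + b) := by grind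
  set d := a - k - k ^ 2 with hd
  have hd_odd : Odd d := by
    have : Even (k * (k + 1)) := Int.even_mul_succ_self k
    grind
  obtain ⟨s, hs⟩ := exists_two_pow_dvd_quadratic (4 * d - 1) (B := 1 - 4 * d) (by grind)
    (hd_odd.sub_odd odd_one) N
  have hone : FormEquiv (2 ^ N) !![a, b; 0, c] !![a, 2 * k + 1; 0, 1] :=
    formEquiv_fin_two_of_subst 1 t 0 1 (by simp [isCoprime_one_left]) (by simp)
      (by rw [← hk]; ring_nf; simp) (by convert ht using 1; ring)
  have hcross : FormEquiv (2 ^ N) !![a, 2 * k + 1; 0, 1] !![d, 1; 0, 1] :=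
    formEquiv_fin_two_of_subst 1 0 (-k) 1 (by simp [isCoprime_one_left])
      (by rw [hd]; ring_nf; simp) (by ring_nf; simp) (by simp)
  refine (hone.trans hcross).trans (formEquiv_fin_two_of_subst (1 - 2 * s) 0 s 1 ?_ ?_ ?_ ?_)
  · simpa using isCoprime_two_pow_of_odd (u := 1 - 2 * s) (by grind) N
  · convert hs using 1
    ring
  · ring_nf
    simp
  · simp

end Binary

section Jordan

open Matrix

theorem exists_formDvd_pow_not_succ {ι : Type*} [Fintype ι] {n : ℤ} {N : ℕ} {A : Matrix ι ι ℤ}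
    (hA : ¬ FormDvd (n ^ N) A) : ∃ r, FormDvd (n ^ r) A ∧ ¬ FormDvd (n ^ (r + 1)) A := by
  induction N with
  | zero => exact absurd (fun x => by simp) hA
  | succ N ih =>
    by_cases h : FormDvd (n ^ N) A
    · exact ⟨N, h, hA⟩
    · exact ih h

theorem odd_of_not_two_pow_succ_dvd {r : ℕ} {z : ℤ} (h : ¬ (2 : ℤ) ^ (r + 1) ∣ 2 ^ r * z) :
    Odd z := by
  contrapose! h
  rw [pow_succ]
  exact mul_dvd_mul_left _ (Int.not_odd_iff_even.1 h).two_dvd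

theorem exists_isJordanBlock_formEquiv_fin_two {a b c : ℤ} (hb : Odd b) (r N : ℕ) :
    ∃ J : Matrix (Fin 2) (Fin 2) ℤ, IsJordanBlock J ∧
      FormEquiv (2 ^ N) ((2 : ℤ) ^ r • !![a, b; 0, c]) J := by
  by_cases h : Even a ∨ Even c
  · exact ⟨_, .hyperbolic r, (formEquiv_hyperbolic hb h N).smul _⟩
  · rw [not_or, Int.not_even_iff_odd, Int.not_even_iff_odd] at h
    exact ⟨_, .anisotropic r, (formEquiv_anisotropic h.1 hb h.2 N).smul _⟩

variable {ι : Type*} [Fintype ι] [DecidableEq ι]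

theorem exists_jordan_splitting_of_offDiagonal {A : Matrix ι ι ℤ} {r : ℕ}
    (hA : FormDvd (2 ^ r) A) {i j : ι} (hij : i ≠ j)
    (hodd : ¬ 2 ^ (r + 1) ∣ A i j + A j i) (N : ℕ) :
    ∃ (e : Fin 2 ⊕ ((Set.range ![i, j])ᶜ : Set ι) ≃ ι) (J : Matrix (Fin 2) (Fin 2) ℤ)
      (D : Matrix _ _ ℤ), IsJordanBlock J ∧
        FormEquiv (2 ^ N) (A.submatrix e e) (fromBlocks J 0 0 D) := by
  obtain ⟨hdiag, hoff⟩ := formDvd_iff.1 hA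
  obtain ⟨a, ha⟩ := hdiag i
  obtain ⟨b, hb⟩ := hoff i j hij
  obtain ⟨c, hc⟩ := hdiag j
  have hb_odd : Odd b := odd_of_not_two_pow_succ_dvd (hb ▸ hodd)
  have hsub : A.submatrix ![i, j] ![i, j] = !![2 ^ r * a, A i j; A j i, 2 ^ r * c] := by
    rw [← ha, ← hc]
    ext x y
    fin_cases x <;> fin_cases y <;> rfl
  have hpolar : A.submatrix ![i, j] ![i, j] + (A.submatrix ![i, j] ![i, j])ᵀ =
      (2 : ℤ) ^ r • !![2 * a, b; b, 2 * c] := by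
    rw [hsub]
    ext x y
    fin_cases x <;> fin_cases y <;> simp <;> linarith
  have hdet : IsCoprime (!![2 * a, b; b, 2 * c]).det ((2 : ℤ) ^ N) :=
    isCoprime_two_pow_of_odd
      (by rw [det_fin_two_of, mul_assoc]; exact (even_two_mul _).sub_odd (hb_odd.mul hb_odd)) N
  obtain ⟨e, D, hD⟩ := exists_formEquiv_submatrix_fromBlocks (injective_pair_iff_ne.2 hij)
    hpolar hdet hoff
  have hblock : FormEquiv (2 ^ N) (A.submatrix ![i, j] ![i, j])
      ((2 : ℤ) ^ r • !![a, b; 0, c]) := by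
    rw [hsub]
    exact (formDvd_fin_two (by simp) (by simp [← hb]) (by simp)).formEquiv
  obtain ⟨J, hJ, hAJ⟩ := exists_isJordanBlock_formEquiv_fin_two (a := a) (c := c) hb_odd r N
  exact ⟨e, J, D, hJ, hD.trans ((hblock.trans hAJ).fromBlocks_left D)⟩

theorem exists_jordan_splitting_of_diagonal {A : Matrix ι ι ℤ} {r : ℕ}
    (hoff : ∀ i j, i ≠ j → 2 ^ (r + 1) ∣ A i j + A j i) {i : ι} (hdvd : 2 ^ r ∣ A i i)
    (hodd : ¬ 2 ^ (r + 1) ∣ A i i) (N : ℕ) :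
    ∃ (e : Fin 1 ⊕ ((Set.range ![i])ᶜ : Set ι) ≃ ι) (J : Matrix (Fin 1) (Fin 1) ℤ)
      (D : Matrix _ _ ℤ), IsJordanBlock J ∧
        FormEquiv (2 ^ N) (A.submatrix e e) (fromBlocks J 0 0 D) := by
  obtain ⟨u, hu⟩ := hdvd
  have hu_odd : Odd u := odd_of_not_two_pow_succ_dvd (hu ▸ hodd)
  have hblock : A.submatrix ![i] ![i] = !![2 ^ r * u] := by
    ext x y
    fin_cases x
    fin_cases y
    exact hu
  have hpolar : A.submatrix ![i] ![i] + (A.submatrix ![i] ![i])ᵀ =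
      (2 : ℤ) ^ (r + 1) • !![u] := by
    rw [hblock]
    ext x y
    fin_cases x
    fin_cases y
    simp only [Fin.zero_eta, Matrix.add_apply, transpose_apply, Matrix.smul_apply, of_apply,
      cons_val_zero, smul_eq_mul]
    ring
  obtain ⟨e, D, hD⟩ := exists_formEquiv_submatrix_fromBlocks
    (Function.injective_of_subsingleton _) hpolar
    (by simpa using isCoprime_two_pow_of_odd hu_odd N) hoff
  exact ⟨e, _, D, hblock ▸ .unary r hu_odd, hD⟩

theorem exists_jordan_splitting {N : ℕ} {A : Matrix ι ι ℤ} (hA : ¬ FormDvd (2 ^ N) A) :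
    ∃ (m : ℕ) (f : Fin (m + 1) → ι) (e : Fin (m + 1) ⊕ ((Set.range f)ᶜ : Set ι) ≃ ι)
      (J : Matrix (Fin (m + 1)) (Fin (m + 1)) ℤ) (D : Matrix _ _ ℤ), IsJordanBlock J ∧
        FormEquiv (2 ^ N) (A.submatrix e e) (fromBlocks J 0 0 D) := by
  obtain ⟨r, hr, hr'⟩ := exists_formDvd_pow_not_succ hA
  by_cases hoff : ∀ i j, i ≠ j → 2 ^ (r + 1) ∣ A i j + A j i
  · obtain ⟨i, hi⟩ : ∃ i, ¬ 2 ^ (r + 1) ∣ A i i := by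
      by_contra! h
      exact hr' (formDvd_iff.2 ⟨h, hoff⟩)
    exact ⟨0, ![i], exists_jordan_splitting_of_diagonal hoff ((formDvd_iff.1 hr).1 i) hi N⟩
  · push Not at hoff
    obtain ⟨i, j, hij, h⟩ := hoff
    exact ⟨1, ![i, j], exists_jordan_splitting_of_offDiagonal hr hij h N⟩

theorem formEquiv_one_neg_one_fin_four (N : ℕ) :
    FormEquiv (2 ^ N) (1 : Matrix (Fin 4) (Fin 4) ℤ) (-1) := by
  obtain ⟨p, q, r, s, h⟩ := Nat.sum_four_squares (2 ^ N - 1)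
  have hnorm : (p : ℤ) ^ 2 + q ^ 2 + r ^ 2 + s ^ 2 = 2 ^ N - 1 := by
    have := congrArg (Nat.cast : ℕ → ℤ) h
    push_cast [Nat.one_le_two_pow] at this
    exact this
  -- multiplication by a quaternion of norm `2 ^ N - 1`
  let P : Matrix (Fin 4) (Fin 4) ℤ :=
    !![p, -q, -r, -s; q, p, -s, r; r, s, p, -q; s, -r, q, p]
  have hP : Pᵀ * P = ((2 : ℤ) ^ N - 1) • 1 := by
    ext i j
    fin_cases i <;> fin_cases j <;>
      simp [P, mul_apply, Fin.sum_univ_four, ← hnorm] <;> ring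
  have hdet_sq : P.det * P.det = ((2 : ℤ) ^ N - 1) ^ 4 := by
    have := congrArg det hP
    rwa [det_mul, det_transpose, det_smul, det_one, Fintype.card_fin, mul_one] at this
  have hdet : IsCoprime (P.det * P.det) (2 ^ N) :=
    hdet_sq ▸ IsCoprime.pow_left ⟨-1, 1, by ring⟩
  refine ⟨P, hdet.of_mul_left_left, fun x => ?_⟩
  rw [Matrix.mul_one, hP, sub_neg_eq_add, sub_smul, one_smul, sub_add_cancel, smul_mulVec,
    dotProduct_smul]
  exact Dvd.intro _ rfl

end Jordan

section CircleChar

/-- The character `t ↦ exp (2 π √-1 t)` of `ℚ/ℤ`. -/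
noncomputable def circleChar : AddChar (AddCircle (1 : ℚ)) ℂ where
  toFun := gaussTerm 1
  map_zero_eq_one' := by simpa using gaussTerm_coe 1 0
  map_add_eq_mul' s t := by
    induction s using QuotientAddGroup.induction_on with | _ s => ?_
    induction t using QuotientAddGroup.induction_on with | _ t => ?_
    have h := gaussTerm_coe 1 (s + t)
    rw [AddCircle.coe_add] at h
    refine h.trans ?_
    rw [gaussTerm_coe, gaussTerm_coe, ← Complex.exp_add]
    congr 1
    push_cast
    ring

theorem circleChar_coe (t : ℚ) :
    circleChar (t : AddCircle (1 : ℚ)) = Complex.exp (2 * Real.pi * Complex.I * t) := by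
  refine (gaussTerm_coe 1 t).trans ?_
  congr 1
  rw [PNat.one_coe]
  ring

theorem gaussTerm_eq_circleChar (k : ℕ+) (t : AddCircle (1 : ℚ)) :
    gaussTerm k t = circleChar ((2 ^ ((k : ℕ) - 1) : ℤ) • t) := by
  obtain ⟨t, rfl⟩ := QuotientAddGroup.mk_surjective t
  obtain ⟨n, hn⟩ := Nat.exists_eq_add_of_lt k.pos
  have hexp : (2 ^ ((k : ℕ) - 1) : ℤ) • (t : AddCircle (1 : ℚ)) =
      (((2 ^ n : ℤ) • t : ℚ) : AddCircle (1 : ℚ)) := by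
    rw [hn, zero_add, Nat.add_sub_cancel, AddCircle.coe_zsmul]
  refine (gaussTerm_coe k t).trans ?_
  rw [hexp, circleChar_coe, hn]
  congr 1
  push_cast [zsmul_eq_mul, pow_succ]
  ring

theorem circleChar_eq_one_iff {t : AddCircle (1 : ℚ)} : circleChar t = 1 ↔ t = 0 := by
  obtain ⟨t, rfl⟩ := QuotientAddGroup.mk_surjective t
  change circleChar (t : AddCircle (1 : ℚ)) = 1 ↔ (t : AddCircle (1 : ℚ)) = 0
  rw [circleChar_coe, Complex.exp_eq_one_iff, AddCircle.coe_eq_zero_iff]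
  refine exists_congr fun n => ?_
  rw [mul_comm, mul_left_inj' Complex.two_pi_I_ne_zero, zsmul_one, eq_comm]
  norm_cast

theorem norm_circleChar (t : AddCircle (1 : ℚ)) : ‖circleChar t‖ = 1 := by
  obtain ⟨t, rfl⟩ := QuotientAddGroup.mk_surjective t
  refine (congrArg _ (circleChar_coe t)).trans ?_
  rw [show (2 * Real.pi * Complex.I * t : ℂ) = ((2 * Real.pi * t : ℝ) : ℂ) *
    Complex.I by push_cast; ring, Complex.norm_exp_ofReal_mul_I]

theorem conj_circleChar (t : AddCircle (1 : ℚ)) : conj (circleChar t) = circleChar (-t) := by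
  rw [AddChar.map_neg_eq_inv, Complex.inv_eq_conj (norm_circleChar t)]

theorem circleChar_sum {ι : Type*} (s : Finset ι) (t : ι → AddCircle (1 : ℚ)) :
    circleChar (∑ i ∈ s, t i) = ∏ i ∈ s, circleChar (t i) :=
  map_prod circleChar.toMonoidHom (fun i => Multiplicative.ofAdd (t i)) s

theorem isIntegral_circleChar (t : AddCircle (1 : ℚ)) : IsIntegral ℤ (circleChar t) := by
  obtain ⟨t, rfl⟩ := QuotientAddGroup.mk_surjective t
  have htorsion : t.den • (t : AddCircle (1 : ℚ)) = 0 := by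
    rw [← AddCircle.coe_nsmul, AddCircle.coe_eq_zero_iff]
    exact ⟨t.num, by simp [Rat.den_mul_eq_num]⟩
  refine IsIntegral.of_pow t.den_pos ?_
  have hpow := AddChar.map_nsmul_eq_pow circleChar t.den (t : AddCircle (1 : ℚ))
  rw [htorsion, AddChar.map_zero_eq_one] at hpow
  exact hpow ▸ isIntegral_one

theorem sum_fin_circleChar_nsmul {n : ℕ} {t : AddCircle (1 : ℚ)} (ht : n • t = 0) :
    ∑ j : Fin n, circleChar ((j : ℕ) • t) = if t = 0 then (n : ℂ) else 0 := by
  simp_rw [AddChar.map_nsmul_eq_pow]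
  rw [Fin.sum_univ_eq_sum_range fun j => circleChar t ^ j]
  split_ifs with h
  · simp [h]
  · rw [geom_sum_eq (circleChar_eq_one_iff.not.2 h), ← AddChar.map_nsmul_eq_pow, ht,
      AddChar.map_zero_eq_one, sub_self, zero_div]

end CircleChar

section CharSum

variable {X Y : Type*} [Fintype X] [Fintype Y]

/-- The Gauss sum `∑ x, exp (2 π √-1 q(x))` of a function `q` with values in `ℚ/ℤ`. -/
noncomputable def charSum (q : X → AddCircle (1 : ℚ)) : ℂ :=
  ∑ x, circleChar (q x)

theorem conj_charSum (q : X → AddCircle (1 : ℚ)) :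
    conj (charSum q) = charSum fun x => -q x := by
  simp [charSum, conj_circleChar]

theorem charSum_congr_equiv (e : X ≃ Y) {p : X → AddCircle (1 : ℚ)} {q : Y → AddCircle (1 : ℚ)}
    (h : ∀ x, q (e x) = p x) : charSum p = charSum q :=
  Fintype.sum_equiv e _ _ fun x => congrArg circleChar (h x).symm

theorem charSum_prod (p : X → AddCircle (1 : ℚ)) (q : Y → AddCircle (1 : ℚ)) :
    charSum (fun z : X × Y => p z.1 + q z.2) = charSum p * charSum q := by
  simp [charSum, Fintype.sum_prod_type, AddChar.map_add_eq_mul, Finset.sum_mul_sum]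

theorem charSum_pow (q : X → AddCircle (1 : ℚ)) (n : ℕ) :
    charSum q ^ n = charSum fun x : Fin n → X => ∑ i, q (x i) := by
  simp only [charSum, Fintype.sum_pow, circleChar_sum]

theorem charSum_addMonoidHom {X : Type*} [AddCommGroup X] [Fintype X]
    (f : X →+ AddCircle (1 : ℚ)) [Decidable (f = 0)] :
    charSum f = if f = 0 then (Fintype.card X : ℂ) else 0 := by
  have hzero : circleChar.compAddMonoidHom f = 0 ↔ f = 0 := by
    simp only [DFunLike.ext_iff, AddChar.compAddMonoidHom_apply, AddChar.zero_apply,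
      circleChar_eq_one_iff, AddMonoidHom.zero_apply]
  have hsum := AddChar.sum_eq_ite (circleChar.compAddMonoidHom f)
  simp only [hzero] at hsum
  exact hsum

/-- Conjugates the equality `h` by the Galois automorphism `ζ ↦ ζ ^ u`. -/
theorem charSum_nsmul_congr {n : ℕ} [NeZero n] {p : X → AddCircle (1 : ℚ)}
    {q : Y → AddCircle (1 : ℚ)} (hp : ∀ x, n • p x = 0) (hq : ∀ y, n • q y = 0)
    (h : charSum p = charSum q) {u : ℕ} (hu : u.Coprime n) :
    charSum (fun x => u • p x) = charSum fun y => u • q y := by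
  have hζ := Complex.isPrimitiveRoot_exp n (NeZero.ne n)
  set ζ := Complex.exp (2 * Real.pi * Complex.I / n)
  have exists_pow_eq {t : AddCircle (1 : ℚ)} (ht : n • t = 0) : ∃ m : ℕ, circleChar t = ζ ^ m := by
    have hpow : circleChar t ^ n = 1 := by
      rw [← AddChar.map_nsmul_eq_pow, ht, AddChar.map_zero_eq_one]
    obtain ⟨m, -, hm⟩ := hζ.eq_pow_of_pow_eq_one hpow
    exact ⟨m, hm.symm⟩
  choose f hf using fun x => exists_pow_eq (hp x)
  choose g hg using fun y => exists_pow_eq (hq y)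
  let P : Polynomial ℤ := ∑ x, Polynomial.X ^ f x - ∑ y, Polynomial.X ^ g y
  have aeval_P (z : ℂ) : Polynomial.aeval z P = ∑ x, z ^ f x - ∑ y, z ^ g y := by
    simp [P]
  have root : Polynomial.aeval ζ P = 0 := by
    rw [aeval_P, sub_eq_zero]
    simpa only [charSum, hf, hg] using h
  obtain ⟨Q, hQ⟩ : minpoly ℤ ζ ∣ P :=
    minpoly.isIntegrallyClosed_dvd (hζ.isIntegral (NeZero.pos n)) root
  have root_pow : Polynomial.aeval (ζ ^ u) P = 0 := by
    rw [hQ, hζ.minpoly_eq_pow_coprime hu, map_mul, minpoly.aeval, zero_mul]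
  rw [aeval_P, sub_eq_zero] at root_pow
  simpa only [charSum, AddChar.map_nsmul_eq_pow, hf, hg, ← pow_mul, mul_comm] using root_pow

theorem charSum_zsmul_congr {n : ℕ} [NeZero n] {p : X → AddCircle (1 : ℚ)}
    {q : Y → AddCircle (1 : ℚ)} (hp : ∀ x, n • p x = 0) (hq : ∀ y, n • q y = 0)
    (h : charSum p = charSum q) {u : ℤ} (hu : IsCoprime u n) :
    charSum (fun x => u • p x) = charSum fun y => u • q y := by
  have hcop : u.natAbs.Coprime n := Int.isCoprime_iff_gcd_eq_one.1 hu
  have habs := charSum_nsmul_congr hp hq h hcop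
  rcases Int.natAbs_eq u with hu | hu <;> rw [hu]
  · simpa only [natCast_zsmul] using habs
  · simpa only [neg_smul, natCast_zsmul, conj_charSum] using congrArg conj habs

end CharSum

section QuadraticCharSum

variable {X : Type*} [AddCommGroup X] [Fintype X] {q : X → AddCircle (1 : ℚ)}
  {b : X →+ X →+ AddCircle (1 : ℚ)}

theorem charSum_mul_conj [Fintype b.ker] (h : ∀ z x, q (z + x) = q z + q x + b z x) :
    charSum q * conj (charSum q) = Fintype.card X * charSum fun z : b.ker => q z := by
  classical
  have shift (x : X) : ∑ y, circleChar (-q x) * circleChar (q y) =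
      ∑ z, circleChar (q z) * circleChar (b z x) := by
    rw [← Equiv.sum_comp (Equiv.addRight x)]
    refine Finset.sum_congr rfl fun z _ => ?_
    rw [← AddChar.map_add_eq_mul, ← AddChar.map_add_eq_mul, Equiv.coe_addRight, h]
    congr 1
    abel
  calc charSum q * conj (charSum q)
      = ∑ x, ∑ y, circleChar (-q x) * circleChar (q y) := by
        rw [conj_charSum, mul_comm, charSum, charSum, Finset.sum_mul_sum]
    _ = ∑ z, circleChar (q z) * charSum (b z) := by
        simp_rw [shift, charSum, Finset.mul_sum]
        exact Finset.sum_comm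
    _ = ∑ z, if z ∈ b.ker then Fintype.card X * circleChar (q z) else 0 :=
        Finset.sum_congr rfl fun z _ => by
          rw [charSum_addMonoidHom]
          simp only [AddMonoidHom.mem_ker, mul_comm (circleChar (q z)), ite_mul, zero_mul]
    _ = Fintype.card X * charSum fun z : b.ker => q z := by
        rw [← Finset.sum_filter, charSum, Finset.mul_sum]
        exact Finset.sum_subtype _ (by simp) fun z => Fintype.card X * circleChar (q z)

theorem charSum_mul_conj_of_ne_zero (h : ∀ z x, q (z + x) = q z + q x + b z x)
    (hne : charSum q ≠ 0) :
    charSum q * conj (charSum q) = Fintype.card X * Nat.card b.ker := by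
  classical
  let f : b.ker →+ AddCircle (1 : ℚ) := AddMonoidHom.mk' (fun z => q z) fun z x => by
    simp only [AddSubgroup.coe_add, h, AddMonoidHom.mem_ker.1 z.2, AddMonoidHom.zero_apply,
      add_zero]
  have hker : charSum (fun z : b.ker => q z) = if f = 0 then (Fintype.card b.ker : ℂ) else 0 :=
    charSum_addMonoidHom f
  have hmul := charSum_mul_conj h
  rw [hker] at hmul
  split_ifs at hmul
  · rwa [Nat.card_eq_fintype_card]
  · rw [mul_zero, mul_eq_zero, map_eq_zero, or_self] at hmul
    exact absurd hmul hne

end QuadraticCharSum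

section FixedPoints

variable {X : Type*} [Fintype X]

theorem charSum_eq_sum_card_fiber (q : X → AddCircle (1 : ℚ)) {s : Finset (AddCircle (1 : ℚ))}
    (hs : ∀ x, q x ∈ s) :
    charSum q = ∑ v ∈ s, (Nat.card {x // q x = v} : ℂ) * circleChar v := by
  classical
  rw [charSum, ← Finset.sum_fiberwise_of_maps_to' (fun x _ => hs x)]
  refine Finset.sum_congr rfl fun v _ => ?_
  rw [Finset.sum_const, nsmul_eq_mul, Nat.card_eq_fintype_card, Fintype.card_subtype]

theorem card_modEq_card_fixedPoints_fiber {X Y : Type*} [Finite X] {p : ℕ} [Fact p.Prime]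
    {f : X → X} (hf : f^[p] = id) {q : X → Y} (hq : ∀ x, q (f x) = q x) (v : Y) :
    Nat.card {x // q x = v} ≡ Nat.card {x : Function.fixedPoints f // q x = v} [MOD p] := by
  classical
  have := Fintype.ofFinite X
  let g : Function.End {x // q x = v} := fun x => ⟨f x, (hq x).trans x.2⟩
  have coe_semiconj : Function.Semiconj Subtype.val g f := fun _ => rfl
  have hg : g ^ p ^ 1 = 1 := by
    rw [pow_one, hom_coe_pow (fun g : Function.End {x // q x = v} => (g : _ → _)) rfl
      (fun _ _ => rfl) g p]
    funext x
    exact Subtype.ext ((coe_semiconj.iterate_right p x).trans (congrFun hf _))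
  let e : Function.fixedPoints g ≃ {x : Function.fixedPoints f // q x = v} :=
    { toFun x := ⟨⟨x, congrArg Subtype.val x.2⟩, x.1.2⟩
      invFun x := ⟨⟨x, x.2⟩, Subtype.ext x.1.2⟩ }
  simpa only [← Nat.card_eq_fintype_card, Nat.card_congr e] using
    Equiv.Perm.card_fixedPoints_modEq hg

theorem exists_charSum_eq_charSum_fixedPoints_add {p : ℕ} [Fact p.Prime] {f : X → X}
    [Fintype (Function.fixedPoints f)] (hf : f^[p] = id) {q : X → AddCircle (1 : ℚ)}
    (hq : ∀ x, q (f x) = q x) :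
    ∃ α : ℂ, IsIntegral ℤ α ∧
      charSum q = charSum (fun x : Function.fixedPoints f => q x) + p * α := by
  classical
  have fiber (v) : ∃ m : ℤ, (Nat.card {x // q x = v} : ℤ) =
      Nat.card {x : Function.fixedPoints f // q x = v} + p * m := by
    obtain ⟨m, hm⟩ :=
      (Int.natCast_modEq_iff.2 (card_modEq_card_fixedPoints_fiber hf hq v)).symm.dvd
    exact ⟨m, by linarith⟩
  choose m hm using fiber
  refine ⟨∑ v ∈ Finset.univ.image q, (m v : ℂ) * circleChar v, ?_, ?_⟩
  · exact IsIntegral.sum _ fun v _ => isIntegral_algebraMap.mul (isIntegral_circleChar v)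
  · have mem_image (x : X) : q x ∈ Finset.univ.image q :=
      Finset.mem_image_of_mem q (Finset.mem_univ x)
    rw [charSum_eq_sum_card_fiber q mem_image,
      charSum_eq_sum_card_fiber (fun x : Function.fixedPoints f => q x) fun x => mem_image x,
      Finset.mul_sum, ← Finset.sum_add_distrib]
    refine Finset.sum_congr rfl fun v _ => ?_
    have hv : (Nat.card {x // q x = v} : ℂ) =
        Nat.card {x : Function.fixedPoints f // q x = v} + p * m v := by exact_mod_cast hm v
    rw [hv]
    ring

theorem dvd_of_intCast_eq_mul_isIntegral {m n : ℤ} {α : ℂ} (hα : IsIntegral ℤ α)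
    (h : (n : ℂ) = m * α) : m ∣ n := by
  rcases eq_or_ne m 0 with rfl | hm
  · simpa using h
  have hα' : α = algebraMap ℚ ℂ (n / m) := by
    have : (m : ℂ) ≠ 0 := Int.cast_ne_zero.2 hm
    simp only [eq_ratCast, Rat.cast_div, Rat.cast_intCast, h]
    field_simp
  rw [hα', isIntegral_algebraMap_iff (algebraMap ℚ ℂ).injective] at hα
  obtain ⟨k, hk⟩ := IsIntegrallyClosed.isIntegral_iff.1 hα
  refine ⟨k, ?_⟩
  rw [eq_intCast, eq_div_iff (Int.cast_ne_zero.2 hm)] at hk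
  rw [mul_comm]
  exact_mod_cast hk.symm

end FixedPoints

section MatForm

variable {G ι κ : Type*} [AddCommGroup G] [Fintype ι] [Fintype κ]

/-- The quadratic form `x ↦ ∑ i j, A i j φ(x i, x j)` on `ι → G`. -/
def matForm (φ : G →+ G →+ AddCircle (1 : ℚ)) (A : Matrix ι ι ℤ) (x : ι → G) :
    AddCircle (1 : ℚ) :=
  ∑ i, ∑ j, A i j • φ (x i) (x j)

/-- The pairing `(x, y) ↦ ∑ i j, C i j φ(x i, y j)` on `ι → G`; for `C = A + Aᵀ` it is the polar
form of `matForm φ A`. -/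
def matPairing (φ : G →+ G →+ AddCircle (1 : ℚ)) (C : Matrix ι ι ℤ) :
    (ι → G) →+ (ι → G) →+ AddCircle (1 : ℚ) :=
  ∑ i, ∑ j, C i j • (φ.comp (Pi.evalAddMonoidHom (fun _ => G) i)).compl₂
    (Pi.evalAddMonoidHom (fun _ => G) j)

variable {φ : G →+ G →+ AddCircle (1 : ℚ)}

theorem matPairing_apply (C : Matrix ι ι ℤ) (x y : ι → G) :
    matPairing φ C x y = ∑ i, ∑ j, C i j • φ (x i) (y j) := by
  simp [matPairing]

theorem matForm_add (hφ : ∀ x y, φ x y = φ y x) (A : Matrix ι ι ℤ) (x y : ι → G) :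
    matForm φ A (x + y) =
      matForm φ A x + matForm φ A y + matPairing φ (A + A.transpose) x y := by
  have swap : ∑ i, ∑ j, A i j • φ (y i) (x j) = ∑ i, ∑ j, A j i • φ (x i) (y j) := by
    rw [Finset.sum_comm]
    simp_rw [hφ (y _) (x _)]
  simp only [matForm, matPairing_apply, Pi.add_apply, map_add, AddMonoidHom.add_apply, smul_add,
    Finset.sum_add_distrib, Matrix.add_apply, Matrix.transpose_apply, add_smul, swap]
  abel

theorem matForm_sub (A B : Matrix ι ι ℤ) (x : ι → G) :
    matForm φ (A - B) x = matForm φ A x - matForm φ B x := by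
  simp only [matForm, Matrix.sub_apply, sub_smul, Finset.sum_sub_distrib]

theorem zsmul_form_eq_zero_of_dvd {n : ℤ} (hn : ∀ x : G, n • x = 0) {a : ℤ} (h : n ∣ a)
    (x y : G) : a • φ x y = 0 := by
  obtain ⟨c, rfl⟩ := h
  rw [mul_comm, mul_smul, ← AddMonoidHom.smul_apply, ← map_zsmul φ, hn, map_zero,
    AddMonoidHom.zero_apply, smul_zero]

theorem two_pow_nsmul_zsmul_form_eq_zero {N : ℕ} (hG : ∀ x : G, (2 ^ N : ℤ) • x = 0) (a : ℤ)
    (x y : G) : 2 ^ N • a • φ x y = 0 := by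
  rw [← natCast_zsmul, smul_smul, Nat.cast_pow, Nat.cast_ofNat]
  exact zsmul_form_eq_zero_of_dvd hG (dvd_mul_right _ _) x y

theorem matForm_eq_zero_of_formDvd (hφ : ∀ x y, φ x y = φ y x) {n : ℤ}
    (hn : ∀ x : G, n • x = 0) {A : Matrix ι ι ℤ} (hA : FormDvd n A) (x : ι → G) :
    matForm φ A x = 0 := by
  classical
  obtain ⟨hdiag, hoff⟩ := formDvd_iff.1 hA
  refine sum_sum_eq_zero_of_alternating (fun i => zsmul_form_eq_zero_of_dvd hn (hdiag i) _ _)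
    fun i j hij => ?_
  rw [hφ (x j) (x i), ← add_smul]
  exact zsmul_form_eq_zero_of_dvd hn (hoff i j hij) _ _

theorem matForm_congr (hφ : ∀ x y, φ x y = φ y x) {n : ℤ} (hn : ∀ x : G, n • x = 0)
    {A B : Matrix ι ι ℤ} (h : FormDvd n (A - B)) : matForm φ A = matForm φ B :=
  funext fun x => sub_eq_zero.1 (matForm_sub (φ := φ) A B x ▸
    matForm_eq_zero_of_formDvd hφ hn h x)

theorem matForm_comp_mulVec (A : Matrix ι ι ℤ) (P : Matrix ι κ ℤ) (y : κ → G) :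
    matForm φ A (fun i => ∑ k, P i k • y k) = matForm φ (P.transpose * A * P) y := by
  have hl : matForm φ A (fun i => ∑ k, P i k • y k) =
      ∑ i, ∑ j, ∑ k, ∑ l, (P i k * A i j * P j l) • φ (y k) (y l) := by
    refine Finset.sum_congr rfl fun i _ => Finset.sum_congr rfl fun j _ => ?_
    simp only [map_sum, map_zsmul, AddMonoidHom.finsetSum_apply, AddMonoidHom.smul_apply,
      Finset.smul_sum, smul_smul]
    rw [Finset.sum_comm]
    refine Finset.sum_congr rfl fun k _ => Finset.sum_congr rfl fun l _ => ?_
    congr 1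
    ring
  have hr : matForm φ (P.transpose * A * P) y =
      ∑ k, ∑ l, ∑ i, ∑ j, (P i k * A i j * P j l) • φ (y k) (y l) := by
    refine Finset.sum_congr rfl fun k _ => Finset.sum_congr rfl fun l _ => ?_
    simp only [Matrix.mul_apply, Matrix.transpose_apply, Finset.sum_mul, Finset.sum_smul]
    exact Finset.sum_comm
  rw [hl, hr]
  calc ∑ i, ∑ j, ∑ k, ∑ l, (P i k * A i j * P j l) • φ (y k) (y l)
      = ∑ p : ι × ι, ∑ q : κ × κ, (P p.1 q.1 * A p.1 p.2 * P p.2 q.2) • φ (y q.1) (y q.2) := by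
        simp only [Fintype.sum_prod_type]
    _ = ∑ q : κ × κ, ∑ p : ι × ι, (P p.1 q.1 * A p.1 p.2 * P p.2 q.2) • φ (y q.1) (y q.2) :=
        Finset.sum_comm
    _ = ∑ k, ∑ l, ∑ i, ∑ j, (P i k * A i j * P j l) • φ (y k) (y l) := by
        simp only [Fintype.sum_prod_type]

theorem eq_zero_of_isCoprime_zsmul {m n : ℤ} (h : IsCoprime m n) {x : G} (hm : m • x = 0)
    (hn : n • x = 0) : x = 0 := by
  obtain ⟨a, b, hab⟩ := h
  rw [← one_zsmul x, ← hab, add_smul, mul_smul, mul_smul, hm, hn, smul_zero, smul_zero, add_zero]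

theorem eq_zero_of_sum_zsmul_eq_zero [DecidableEq ι] {n : ℤ} {P : Matrix ι ι ℤ}
    (hP : IsCoprime P.det n) {x : ι → G} (hn : ∀ i, n • x i = 0)
    (h : ∀ i, ∑ j, P i j • x j = 0) : x = 0 := by
  funext l
  refine eq_zero_of_isCoprime_zsmul hP ?_ (hn l)
  calc P.det • x l = ∑ j, (P.adjugate * P) l j • x j := by
        simp only [Matrix.adjugate_mul, Matrix.smul_apply, Matrix.one_apply, smul_eq_mul, mul_ite,
          mul_one, mul_zero, ite_smul, zero_smul, Finset.sum_ite_eq, Finset.mem_univ, if_true]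
    _ = ∑ i, P.adjugate l i • ∑ j, P i j • x j := by
        simp only [Matrix.mul_apply, Finset.sum_smul, Finset.smul_sum, smul_smul]
        exact Finset.sum_comm
    _ = 0 := by simp only [h, smul_zero, Finset.sum_const_zero]

theorem card_ker_matPairing [DecidableEq ι] (hφ : Function.Injective φ) {n : ℤ}
    (hn : ∀ x : G, n • x = 0) (d : ℕ) {S : Matrix ι ι ℤ} (hS : IsCoprime S.det n) :
    Nat.card (matPairing φ (d • S)).ker =
      Nat.card (nsmulAddMonoidHom (α := G) d).ker ^ Fintype.card ι := by
  have apply_single (x : ι → G) (j : ι) (y : G) : matPairing φ (d • S) x (Pi.single j y) =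
      φ (∑ i, S.transpose j i • d • x i) y := by
    simp only [matPairing_apply, Pi.single_apply, apply_ite, map_zero, smul_zero,
      Finset.sum_ite_eq', Finset.mem_univ, if_true, map_sum, map_zsmul, map_nsmul,
      AddMonoidHom.finsetSum_apply, AddMonoidHom.smul_apply, Matrix.smul_apply,
      Matrix.transpose_apply, smul_assoc, smul_comm d]
  have mem_ker_iff (x : ι → G) :
      x ∈ (matPairing φ (d • S)).ker ↔ ∀ i, x i ∈ (nsmulAddMonoidHom (α := G) d).ker := by
    simp only [AddMonoidHom.mem_ker, nsmulAddMonoidHom_apply]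
    constructor
    · intro hx
      refine congrFun (eq_zero_of_sum_zsmul_eq_zero (P := S.transpose) (x := fun i => d • x i)
        (by rwa [Matrix.det_transpose]) (fun i => hn _) fun j => hφ ?_)
      ext y
      rw [← apply_single, hx, map_zero, AddMonoidHom.zero_apply, AddMonoidHom.zero_apply]
    · intro hx
      have form_eq_zero (i : ι) (y : G) : d • φ (x i) y = 0 := by
        rw [← AddMonoidHom.smul_apply, ← map_nsmul, hx, map_zero, AddMonoidHom.zero_apply]
      refine DFunLike.ext _ _ fun y => ?_
      simp only [matPairing_apply, Matrix.smul_apply, smul_assoc, smul_comm d, form_eq_zero,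
        smul_zero, Finset.sum_const_zero, AddMonoidHom.zero_apply]
  rw [Nat.card_congr ((Equiv.subtypeEquivRight mem_ker_iff).trans Equiv.subtypePiEquivPi),
    Nat.card_pi, Finset.prod_const, Finset.card_univ]

variable [Fintype G] [DecidableEq ι] [DecidableEq κ]

theorem FormEquiv.charSum_matForm_eq (hφ : ∀ x y, φ x y = φ y x) {n : ℤ}
    (hn : ∀ x : G, n • x = 0) {A B : Matrix ι ι ℤ} (h : FormEquiv n A B) :
    charSum (matForm φ A) = charSum (matForm φ B) := by
  obtain ⟨P, hP, hAB⟩ := h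
  let subst : (ι → G) →+ (ι → G) := AddMonoidHom.mk' (fun x i => ∑ k, P i k • x k) fun x y => by
    ext i
    simp only [Pi.add_apply, smul_add, Finset.sum_add_distrib]
  have subst_injective : Function.Injective subst :=
    (injective_iff_map_eq_zero subst).2 fun x hx =>
      eq_zero_of_sum_zsmul_eq_zero hP (fun i => hn (x i)) (congrFun hx)
  rw [← matForm_congr hφ hn hAB]
  exact (charSum_congr_equiv
    (Equiv.ofBijective subst (Finite.injective_iff_bijective.1 subst_injective))
    (matForm_comp_mulVec A P)).symm

theorem charSum_matForm_submatrix (A : Matrix ι ι ℤ) (e : κ ≃ ι) :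
    charSum (matForm φ (A.submatrix e e)) = charSum (matForm φ A) := by
  refine (charSum_congr_equiv (e.arrowCongr (Equiv.refl G)).symm fun x => ?_).symm
  exact e.sum_comp (fun i => ∑ j, A i (e j) • φ (x i) (x (e j))) |>.trans
    (Finset.sum_congr rfl fun i _ => e.sum_comp fun j => A i j • φ (x i) (x j))

theorem charSum_matForm_fromBlocks (A : Matrix ι ι ℤ) (D : Matrix κ κ ℤ) :
    charSum (matForm φ (Matrix.fromBlocks A 0 0 D)) =
      charSum (matForm φ A) * charSum (matForm φ D) := by
  rw [← charSum_prod]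
  refine charSum_congr_equiv (Equiv.sumArrowEquivProdArrow ι κ G) fun x => ?_
  simp [matForm, Fintype.sum_sum_type]

theorem charSum_matForm_of_formDvd (hφ : ∀ x y, φ x y = φ y x) {n : ℤ}
    (hn : ∀ x : G, n • x = 0) {A : Matrix ι ι ℤ} (hA : FormDvd n A) :
    charSum (matForm φ A) = (Fintype.card G : ℂ) ^ Fintype.card ι := by
  simp [charSum, matForm_eq_zero_of_formDvd hφ hn hA]

theorem charSum_matForm_mul_conj (hs : ∀ x y, φ x y = φ y x) (hφ : Function.Injective φ) {n : ℤ}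
    (hn : ∀ x : G, n • x = 0) {A S : Matrix ι ι ℤ} {d : ℕ} (hA : A + A.transpose = d • S)
    (hS : IsCoprime S.det n) (hne : charSum (matForm φ A) ≠ 0) :
    charSum (matForm φ A) * conj (charSum (matForm φ A)) = ((Fintype.card G : ℂ) *
      Nat.card (nsmulAddMonoidHom (α := G) d).ker) ^ Fintype.card ι := by
  rw [charSum_mul_conj_of_ne_zero (matForm_add hs A) hne, hA, card_ker_matPairing hφ hn d hS,
    Fintype.card_fun, mul_pow]
  push_cast
  rfl

end MatForm

theorem charSum_matForm_eq_of_isJordanBlock {G H ι : Type*} [AddCommGroup G] [AddCommGroup H]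
    [Fintype G] [Fintype H] [Fintype ι] [DecidableEq ι] {φ : G →+ G →+ AddCircle (1 : ℚ)}
    {ψ : H →+ H →+ AddCircle (1 : ℚ)} (hφ : ∀ x y, φ x y = φ y x) (hψ : ∀ x y, ψ x y = ψ y x)
    {N : ℕ} (hG : ∀ x : G, (2 ^ N : ℤ) • x = 0) (hH : ∀ x : H, (2 ^ N : ℤ) • x = 0)
    (hcard : Fintype.card G = Fintype.card H)
    (hJ : ∀ {m : ℕ} {J : Matrix (Fin m) (Fin m) ℤ}, IsJordanBlock J →
      charSum (matForm φ J) = charSum (matForm ψ J)) (A : Matrix ι ι ℤ) :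
    charSum (matForm φ A) = charSum (matForm ψ A) := by
  classical
  induction hk : Fintype.card ι using Nat.strong_induction_on generalizing ι with
  | _ k ih =>
    by_cases hA : FormDvd (2 ^ N) A
    · rw [charSum_matForm_of_formDvd hφ hG hA, charSum_matForm_of_formDvd hψ hH hA, hcard]
    · obtain ⟨m, f, e, J, D, hJblock, hequiv⟩ := exists_jordan_splitting hA
      have hlt : Fintype.card ((Set.range f)ᶜ : Set ι) < k := by
        rw [← hk, ← Fintype.card_congr e, Fintype.card_sum, Fintype.card_fin]
        omega
      rw [← charSum_matForm_submatrix A e, ← charSum_matForm_submatrix A e,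
        hequiv.charSum_matForm_eq hφ hG, hequiv.charSum_matForm_eq hψ hH,
        charSum_matForm_fromBlocks, charSum_matForm_fromBlocks, hJ hJblock, ih _ hlt D rfl]

section JordanBlockSums

variable {G : Type*} [AddCommGroup G] [Fintype G] {φ : G →+ G →+ AddCircle (1 : ℚ)}

theorem charSum_matForm_fin_one (a : ℤ) :
    charSum (matForm φ !![a]) = charSum fun x => a • φ x x :=
  charSum_congr_equiv (Equiv.funUnique (Fin 1) G) fun x => by simp [matForm]

theorem charSum_unary_pow_four (s : ℤ) : charSum (fun x => s • φ x x) ^ 4 =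
    charSum (matForm φ (s • (1 : Matrix (Fin 4) (Fin 4) ℤ))) := by
  rw [charSum_pow]
  congr 1
  funext x
  simp [matForm, Matrix.one_apply]

theorem conj_charSum_unary_pow_four (hs : ∀ x y, φ x y = φ y x) {N : ℕ}
    (hG : ∀ x : G, (2 ^ N : ℤ) • x = 0) (s : ℤ) :
    conj (charSum (fun x => s • φ x x) ^ 4) = charSum (fun x => s • φ x x) ^ 4 := by
  rw [map_pow, conj_charSum]
  simp_rw [← neg_smul]
  rw [charSum_unary_pow_four, charSum_unary_pow_four,
    ((formEquiv_one_neg_one_fin_four N).smul s).charSum_matForm_eq hs hG, smul_neg, neg_smul]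

theorem charSum_unary_mul_conj (hs : ∀ x y, φ x y = φ y x) (hφ : Function.Injective φ) {N : ℕ}
    (hG : ∀ x : G, (2 ^ N : ℤ) • x = 0) (r : ℕ)
    (hne : charSum (fun x => (2 ^ r : ℤ) • φ x x) ≠ 0) :
    charSum (fun x => (2 ^ r : ℤ) • φ x x) * conj (charSum fun x => (2 ^ r : ℤ) • φ x x) =
      Fintype.card G * Nat.card (nsmulAddMonoidHom (α := G) (2 ^ (r + 1))).ker := by
  have hpolar : !![(2 ^ r : ℤ)] + !![(2 ^ r : ℤ)].transpose =
      2 ^ (r + 1) • (1 : Matrix (Fin 1) (Fin 1) ℤ) := by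
    ext i j
    fin_cases i
    fin_cases j
    simp [pow_succ, mul_two]
  rw [← charSum_matForm_fin_one] at hne ⊢
  simpa using charSum_matForm_mul_conj hs hφ hG hpolar (by simp [isCoprime_one_left]) hne

theorem charSum_hyperbolic (hφ : Function.Injective φ) (r : ℕ) :
    charSum (matForm φ ((2 : ℤ) ^ r • !![0, 1; 0, 0])) =
      Fintype.card G * Nat.card (nsmulAddMonoidHom (α := G) (2 ^ r)).ker := by
  classical
  have hform (x : Fin 2 → G) : matForm φ ((2 : ℤ) ^ r • !![0, 1; 0, 0]) x =
      φ ((2 : ℤ) ^ r • x 0) (x 1) := by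
    simp [matForm, Fin.sum_univ_two]
  have hsum : charSum (matForm φ ((2 : ℤ) ^ r • !![0, 1; 0, 0])) =
      ∑ x : G, charSum (φ ((2 : ℤ) ^ r • x)) := by
    rw [charSum_congr_equiv (q := fun z : G × G => φ ((2 : ℤ) ^ r • z.1) z.2)
      (finTwoArrowEquiv G) fun x => (hform x).symm, charSum, Fintype.sum_prod_type]
    rfl
  have hzero (x : G) : φ ((2 : ℤ) ^ r • x) = 0 ↔ x ∈ (nsmulAddMonoidHom (α := G) (2 ^ r)).ker := by
    rw [map_eq_zero_iff φ hφ, AddMonoidHom.mem_ker, nsmulAddMonoidHom_apply, ← natCast_zsmul]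
    norm_cast
  simp_rw [hsum, charSum_addMonoidHom, hzero]
  rw [← Finset.sum_filter, Finset.sum_const, ← Fintype.card_subtype, nsmul_eq_mul, mul_comm,
    Nat.card_eq_fintype_card]

theorem conj_charSum_anisotropic (hs : ∀ x y, φ x y = φ y x) {N : ℕ}
    (hG : ∀ x : G, (2 ^ N : ℤ) • x = 0) (d : ℤ) :
    conj (charSum (matForm φ (d • !![1, 1; 0, 1]))) =
      charSum (matForm φ (d • !![1, 1; 0, 1])) := by
  have hneg : FormEquiv (2 ^ N) (d • !![-1, -1; 0, -1]) (d • !![1, 1; 0, 1]) :=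
    (formEquiv_anisotropic (by decide) (by decide) (by decide) N).smul d
  rw [conj_charSum, ← hneg.charSum_matForm_eq hs hG]
  congr 1
  funext x
  simp [matForm, Fin.sum_univ_two]
  abel

/-- The symmetry `(x, y) ↦ (-x - y, x)` of `x² + xy + y²` has order three and fixes only `0`. -/
theorem exists_charSum_anisotropic_eq (hs : ∀ x y, φ x y = φ y x) {N : ℕ}
    (hG : ∀ x : G, (2 ^ N : ℤ) • x = 0) (d : ℤ) :
    ∃ α : ℂ, IsIntegral ℤ α ∧
      charSum (matForm φ (d • !![1, 1; 0, 1])) = 1 + 3 * α := by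
  classical
  let f : (Fin 2 → G) → Fin 2 → G := fun x => ![-x 0 - x 1, x 0]
  have hf : f^[3] = id := by
    funext x i
    fin_cases i
    · simp [f]
      abel
    · simp [f]
  have hq (x : Fin 2 → G) :
      matForm φ (d • !![1, 1; 0, 1]) (f x) = matForm φ (d • !![1, 1; 0, 1]) x := by
    simp [f, matForm, Fin.sum_univ_two, hs (x 1) (x 0), smul_sub]
    abel
  have fixed_eq_zero {x : Fin 2 → G} (hx : f x = x) : x = 0 := by
    have h₀ : -x 0 - x 1 = x 0 := congrFun hx 0
    have h₁ : x 0 = x 1 := congrFun hx 1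
    have h₃ : (3 : ℤ) • x 1 = 0 := by
      rw [h₁] at h₀
      rw [show (3 : ℤ) • x 1 = x 1 - (-x 1 - x 1) by abel, h₀, sub_self]
    have hx₁ : x 1 = 0 :=
      eq_zero_of_isCoprime_zsmul (isCoprime_two_pow_of_odd (by decide) N) h₃ (hG _)
    funext i
    fin_cases i
    exacts [h₁.trans hx₁, hx₁]
  have : Subsingleton (Function.fixedPoints f) :=
    ⟨fun x y => Subtype.ext ((fixed_eq_zero x.2).trans (fixed_eq_zero y.2).symm)⟩
  have zero_mem : (0 : Fin 2 → G) ∈ Function.fixedPoints f := by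
    funext i
    fin_cases i <;> simp [f]
  have hfixed : charSum (fun x : Function.fixedPoints f =>
      matForm φ (d • !![1, 1; 0, 1]) x) = 1 := by
    rw [charSum, Fintype.sum_subsingleton _ ⟨0, zero_mem⟩]
    simp [matForm]
  obtain ⟨α, hα, h⟩ := exists_charSum_eq_charSum_fixedPoints_add hf hq
  exact ⟨α, hα, by rw [h, hfixed, Nat.cast_ofNat]⟩

theorem charSum_anisotropic_ne_zero (hs : ∀ x y, φ x y = φ y x) {N : ℕ}
    (hG : ∀ x : G, (2 ^ N : ℤ) • x = 0) (d : ℤ) :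
    charSum (matForm φ (d • !![1, 1; 0, 1])) ≠ 0 := by
  intro hzero
  obtain ⟨α, hα, h⟩ := exists_charSum_anisotropic_eq hs hG d
  have h31 : (3 : ℤ) ∣ 1 := dvd_of_intCast_eq_mul_isIntegral hα.neg (by
    push_cast
    linear_combination hzero - h)
  norm_num at h31

theorem charSum_anisotropic_mul_self (hs : ∀ x y, φ x y = φ y x) (hφ : Function.Injective φ)
    {N : ℕ} (hG : ∀ x : G, (2 ^ N : ℤ) • x = 0) (r : ℕ) :
    charSum (matForm φ ((2 : ℤ) ^ r • !![1, 1; 0, 1])) *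
        charSum (matForm φ ((2 : ℤ) ^ r • !![1, 1; 0, 1])) =
      ((Fintype.card G : ℂ) * Nat.card (nsmulAddMonoidHom (α := G) (2 ^ r)).ker) *
        (Fintype.card G * Nat.card (nsmulAddMonoidHom (α := G) (2 ^ r)).ker) := by
  have hpolar : (2 : ℤ) ^ r • (!![1, 1; 0, 1] : Matrix (Fin 2) (Fin 2) ℤ) +
      ((2 : ℤ) ^ r • !![1, 1; 0, 1]).transpose = 2 ^ r • !![2, 1; 1, 2] := by
    ext i j
    fin_cases i <;> fin_cases j <;> simp [mul_two]
  have hdet : Odd (!![2, 1; 1, 2] : Matrix (Fin 2) (Fin 2) ℤ).det := by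
    rw [Matrix.det_fin_two_of]
    decide
  have hmul := charSum_matForm_mul_conj hs hφ hG hpolar (isCoprime_two_pow_of_odd hdet N)
    (charSum_anisotropic_ne_zero hs hG _)
  rwa [conj_charSum_anisotropic hs hG, Fintype.card_fin, pow_two] at hmul

end JordanBlockSums

section JordanBlockSumsEq

variable {G H : Type*} [AddCommGroup G] [AddCommGroup H] [Fintype G] [Fintype H]
  {φ : G →+ G →+ AddCircle (1 : ℚ)} {ψ : H →+ H →+ AddCircle (1 : ℚ)}

theorem charSum_unary_eq {N : ℕ} (hG : ∀ x : G, (2 ^ N : ℤ) • x = 0)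
    (hH : ∀ x : H, (2 ^ N : ℤ) • x = 0) {r : ℕ}
    (h : charSum (fun x => (2 ^ r : ℤ) • φ x x) = charSum fun x => (2 ^ r : ℤ) • ψ x x)
    {u : ℤ} (hu : Odd u) :
    charSum (fun x => (2 ^ r * u) • φ x x) = charSum fun x => (2 ^ r * u) • ψ x x := by
  simp_rw [mul_comm _ u, mul_smul]
  exact charSum_zsmul_congr (fun x => two_pow_nsmul_zsmul_form_eq_zero hG _ x x)
    (fun x => two_pow_nsmul_zsmul_form_eq_zero hH _ x x) h
    (by exact_mod_cast isCoprime_two_pow_of_odd hu N)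

/-- Both sums have square `(|G| |ker 2 ^ r|)²`, and they cannot be opposite, being congruent
modulo `3`. -/
theorem charSum_anisotropic_eq (hφs : ∀ x y, φ x y = φ y x) (hψs : ∀ x y, ψ x y = ψ y x)
    (hφ : Function.Injective φ) (hψ : Function.Injective ψ) {N : ℕ}
    (hG : ∀ x : G, (2 ^ N : ℤ) • x = 0) (hH : ∀ x : H, (2 ^ N : ℤ) • x = 0)
    (hcard : Fintype.card G = Fintype.card H) {r : ℕ}
    (hker : Nat.card (nsmulAddMonoidHom (α := G) (2 ^ r)).ker =
      Nat.card (nsmulAddMonoidHom (α := H) (2 ^ r)).ker) :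
    charSum (matForm φ ((2 : ℤ) ^ r • !![1, 1; 0, 1])) =
      charSum (matForm ψ ((2 : ℤ) ^ r • !![1, 1; 0, 1])) := by
  have hGsq := charSum_anisotropic_mul_self hφs hφ hG r
  have hHsq := charSum_anisotropic_mul_self hψs hψ hH r
  rw [← hcard, ← hker] at hHsq
  obtain ⟨α, hα, hGα⟩ := exists_charSum_anisotropic_eq hφs hG (2 ^ r)
  obtain ⟨β, hβ, hHβ⟩ := exists_charSum_anisotropic_eq hψs hH (2 ^ r)
  refine (mul_self_eq_mul_self_iff.1 (hGsq.trans hHsq.symm)).resolve_right fun hneg => ?_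
  have h32 : (3 : ℤ) ∣ 2 := dvd_of_intCast_eq_mul_isIntegral (hα.add hβ).neg (by
    push_cast
    linear_combination hneg - hGα - hHβ)
  norm_num at h32

end JordanBlockSumsEq

section FourierInversion

theorem sum_circleChar_sum_nsmul {P : Type*} [Fintype P] [DecidableEq P] {n : ℕ}
    {s : P → AddCircle (1 : ℚ)} (hs : ∀ p, n • s p = 0) :
    ∑ A : P → Fin n, circleChar (∑ p, (A p : ℕ) • s p) =
      if s = 0 then (n : ℂ) ^ Fintype.card P else 0 := by
  have hprod := Finset.prod_univ_sum (fun _ : P => (Finset.univ : Finset (Fin n)))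
    fun p j => circleChar ((j : ℕ) • s p)
  simp_rw [circleChar_sum]
  rw [← Fintype.piFinset_univ, ← hprod]
  simp_rw [sum_fin_circleChar_nsmul (hs _)]
  split_ifs with h
  · simp [h]
  · obtain ⟨p, hp⟩ := Function.ne_iff.1 h
    exact Finset.prod_eq_zero (Finset.mem_univ p) (if_neg hp)

theorem sum_circleChar_mul_charSum {X P : Type*} [Fintype X] [Fintype P] [DecidableEq P] {n : ℕ}
    {t : X → P → AddCircle (1 : ℚ)} {c : P → AddCircle (1 : ℚ)}
    (ht : ∀ x p, n • t x p = 0) (hc : ∀ p, n • c p = 0) :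
    ∑ A : P → Fin n, circleChar (-∑ p, (A p : ℕ) • c p) *
        charSum (fun x => ∑ p, (A p : ℕ) • t x p) =
      Nat.card {x // t x = c} * (n : ℂ) ^ Fintype.card P := by
  classical
  have hterm (A : P → Fin n) : circleChar (-∑ p, (A p : ℕ) • c p) *
      charSum (fun x => ∑ p, (A p : ℕ) • t x p) =
      ∑ x, circleChar (∑ p, (A p : ℕ) • (t x - c) p) := by
    rw [charSum, Finset.mul_sum]
    refine Finset.sum_congr rfl fun x _ => ?_
    simp only [← AddChar.map_add_eq_mul, Pi.sub_apply, smul_sub, Finset.sum_sub_distrib,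
      neg_add_eq_sub]
  have horth (x : X) : ∑ A : P → Fin n, circleChar (∑ p, (A p : ℕ) • (t x - c) p) =
      if t x = c then (n : ℂ) ^ Fintype.card P else 0 := by
    rw [sum_circleChar_sum_nsmul fun p => by rw [Pi.sub_apply, smul_sub, ht, hc, sub_zero]]
    simp_rw [sub_eq_zero]
  simp_rw [hterm]
  rw [Finset.sum_comm]
  simp_rw [horth]
  rw [← Finset.sum_filter, Finset.sum_const, Nat.card_eq_fintype_card, Fintype.card_subtype,
    nsmul_eq_mul]

theorem exists_eq_of_charSum_eq {X Y P : Type*} [Fintype X] [Fintype Y] [Fintype P] {n : ℕ}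
    (hn : n ≠ 0) {t : X → P → AddCircle (1 : ℚ)} {s : Y → P → AddCircle (1 : ℚ)}
    (ht : ∀ x p, n • t x p = 0) (hs : ∀ y p, n • s y p = 0)
    (h : ∀ A : P → ℕ, charSum (fun x => ∑ p, A p • t x p) = charSum fun y => ∑ p, A p • s y p)
    (x : X) : ∃ y, s y = t x := by
  classical
  have hcount : (Nat.card {x' // t x' = t x} : ℂ) * (n : ℂ) ^ Fintype.card P =
      Nat.card {y // s y = t x} * (n : ℂ) ^ Fintype.card P := by
    rw [← sum_circleChar_mul_charSum ht (ht x), ← sum_circleChar_mul_charSum hs (ht x)]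
    simp_rw [h]
  have hcard := mul_right_cancel₀ (pow_ne_zero _ (Nat.cast_ne_zero.2 hn)) hcount
  have hpos : 0 < Nat.card {x' // t x' = t x} := Nat.card_pos_iff.2 ⟨⟨⟨x, rfl⟩⟩, inferInstance⟩
  rw [Nat.cast_inj.1 hcard] at hpos
  obtain ⟨⟨y, hy⟩⟩ := (Nat.card_pos_iff.1 hpos).1
  exact ⟨y, hy⟩

end FourierInversion

section Reconstruction

variable {G H : Type*} [AddCommGroup G] [AddCommGroup H] [Fintype G] [Fintype H]
  {φ : G →+ G →+ AddCircle (1 : ℚ)} {ψ : H →+ H →+ AddCircle (1 : ℚ)}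

theorem exists_addEquiv_of_form_eq (hφ : Function.Injective φ) (hψ : Function.Injective ψ)
    (hcard : Fintype.card G = Fintype.card H) {f : G → H}
    (hf : ∀ x y, ψ (f x) (f y) = φ x y) : ∃ e : G ≃+ H, ∀ x y, ψ (e x) (e y) = φ x y := by
  have hinj : Function.Injective f := by
    intro x y hxy
    apply hφ
    ext z
    rw [← hf, ← hf, hxy]
  have hbij : Function.Bijective f := (Fintype.bijective_iff_injective_and_card f).2 ⟨hinj, hcard⟩
  have map_add (x y : G) : f (x + y) = f x + f y := by
    apply hψ
    ext w
    obtain ⟨z, rfl⟩ := hbij.2 w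
    simp [hf]
  exact ⟨AddEquiv.mk' (Equiv.ofBijective f hbij) map_add, hf⟩

theorem exists_addEquiv_of_charSum_eq (hφ : Function.Injective φ) (hψ : Function.Injective ψ)
    (hcard : Fintype.card G = Fintype.card H)
    (h : ∀ (n : ℕ) (A : Matrix (Fin n) (Fin n) ℤ),
      charSum (matForm φ A) = charSum (matForm ψ A)) :
    ∃ e : G ≃+ H, ∀ x y, ψ (e x) (e y) = φ x y := by
  have card_nsmul_left (x y : G) : Fintype.card G • φ x y = 0 := by
    rw [← map_nsmul, card_nsmul_eq_zero, map_zero]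
  have card_nsmul_right (x y : H) : Fintype.card G • ψ x y = 0 := by
    rw [hcard, ← map_nsmul, card_nsmul_eq_zero, map_zero]
  let g := Fintype.equivFin G
  obtain ⟨y, hy⟩ := exists_eq_of_charSum_eq (P := Fin (Fintype.card G) × Fin (Fintype.card G))
    (t := fun (x : Fin (Fintype.card G) → G) p => φ (x p.1) (x p.2))
    (s := fun (y : Fin (Fintype.card G) → H) p => ψ (y p.1) (y p.2))
    Fintype.card_ne_zero (fun x p => card_nsmul_left _ _) (fun y p => card_nsmul_right _ _)
    (fun A => by
      have hA := h _ (Matrix.of fun i j => (A (i, j) : ℤ))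
      unfold matForm at hA
      simpa [Fintype.sum_prod_type] using hA)
    g.symm
  refine exists_addEquiv_of_form_eq hφ hψ hcard (f := fun x => y (g x)) fun x x' => ?_
  simpa using congrFun hy (g x, g x')

end Reconstruction

section EighthPhase

theorem eighthPhase_mul_stdAddChar {r : ℝ} (hr : 0 < r) (n : ZMod 8) :
    eighthPhase (r * ZMod.stdAddChar n) = n := by
  obtain ⟨m, rfl⟩ := ZMod.intCast_surjective n
  rw [ZMod.stdAddChar_coe, ← eighthPhase_eq r hr m, mul_div_assoc, Nat.cast_ofNat]

theorem exists_eq_norm_mul_stdAddChar {z : ℂ} (hz : conj (z ^ 4) = z ^ 4) :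
    ∃ n : ZMod 8, z = ‖z‖ * ZMod.stdAddChar n := by
  rcases eq_or_ne z 0 with rfl | hz₀
  · exact ⟨0, by simp⟩
  have hnorm : (‖z‖ : ℂ) ≠ 0 := by exact_mod_cast norm_ne_zero_iff.2 hz₀
  have hroot : (z / ‖z‖) ^ 8 = 1 := by
    rw [div_pow, div_eq_one_iff_eq (pow_ne_zero _ hnorm)]
    calc z ^ 8 = z ^ 4 * conj (z ^ 4) := by rw [hz]; ring
      _ = (z * conj z) ^ 4 := by rw [map_pow]; ring
      _ = (‖z‖ : ℂ) ^ 8 := by rw [Complex.mul_conj']; ring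
  obtain ⟨n, -, hn⟩ := (Complex.isPrimitiveRoot_exp 8 (by norm_num)).eq_pow_of_pow_eq_one hroot
  refine ⟨(n : ℤ), ?_⟩
  rw [ZMod.stdAddChar_coe, mul_comm, ← div_eq_iff hnorm, ← hn, ← Complex.exp_nat_mul]
  congr 1
  push_cast
  ring

theorem eighthPhase_eq_top_iff {z : ℂ} : eighthPhase z = ⊤ ↔ z = 0 := by
  unfold eighthPhase
  split_ifs with h <;> simp [h]

theorem eighthPhase_zero : eighthPhase 0 = ⊤ := eighthPhase_eq_top_iff.2 rfl

theorem eighthPhase_mul {z w : ℂ} (hz : conj (z ^ 4) = z ^ 4) (hw : conj (w ^ 4) = w ^ 4) :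
    eighthPhase (z * w) = eighthPhase z + eighthPhase w := by
  rcases eq_or_ne z 0 with rfl | hz₀
  · simp [eighthPhase_zero]
  rcases eq_or_ne w 0 with rfl | hw₀
  · simp [eighthPhase_zero]
  obtain ⟨n, hn⟩ := exists_eq_norm_mul_stdAddChar hz
  obtain ⟨m, hm⟩ := exists_eq_norm_mul_stdAddChar hw
  have hzw : z * w = (‖z‖ * ‖w‖ : ℝ) * ZMod.stdAddChar (n + m) := by
    rw [AddChar.map_add_eq_mul, Complex.ofReal_mul, mul_mul_mul_comm, ← hn, ← hm]
  have hz_pos := norm_pos_iff.2 hz₀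
  have hw_pos := norm_pos_iff.2 hw₀
  rw [hzw, eighthPhase_mul_stdAddChar (mul_pos hz_pos hw_pos), hn, hm,
    eighthPhase_mul_stdAddChar hz_pos, eighthPhase_mul_stdAddChar hw_pos, WithTop.coe_add]

theorem eq_of_eighthPhase_eq {z w : ℂ} (hz : conj (z ^ 4) = z ^ 4) (hw : conj (w ^ 4) = w ^ 4)
    (h : eighthPhase z = eighthPhase w) (hnorm : z ≠ 0 → w ≠ 0 → ‖z‖ = ‖w‖) : z = w := by
  rcases eq_or_ne z 0 with rfl | hz₀
  · exact (eighthPhase_eq_top_iff.1 (h ▸ eighthPhase_zero)).symm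
  rcases eq_or_ne w 0 with rfl | hw₀
  · exact eighthPhase_eq_top_iff.1 (h ▸ eighthPhase_zero)
  obtain ⟨n, hn⟩ := exists_eq_norm_mul_stdAddChar hz
  obtain ⟨m, hm⟩ := exists_eq_norm_mul_stdAddChar hw
  rw [hn, hm, eighthPhase_mul_stdAddChar (norm_pos_iff.2 hz₀),
    eighthPhase_mul_stdAddChar (norm_pos_iff.2 hw₀), WithTop.coe_inj] at h
  rw [hn, hm, h, hnorm hz₀ hw₀]

end EighthPhase

section TwoGroup

theorem isPGroup_prod {p : ℕ} {G H : Type*} [Group G] [Group H] (hG : IsPGroup p G)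
    (hH : IsPGroup p H) : IsPGroup p (G × H) := by
  refine isPGroup_iff_pow_pow_eq_one.2 fun z => ?_
  obtain ⟨m, hm⟩ := isPGroup_iff_pow_pow_eq_one.1 hG z.1
  obtain ⟨n, hn⟩ := isPGroup_iff_pow_pow_eq_one.1 hH z.2
  refine ⟨m + n, Prod.ext ?_ ?_⟩
  · rw [Prod.pow_fst, pow_add, pow_mul, hm, one_pow, Prod.fst_one]
  · rw [Prod.pow_snd, pow_add, mul_comm, pow_mul, hn, one_pow, Prod.snd_one]

theorem exists_prime_pow_zsmul_eq_zero {p : ℕ} [Fact p.Prime] {G : Type*} [AddCommGroup G]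
    [Fintype G] (hG : IsPGroup p (Multiplicative G)) :
    ∃ N : ℕ, Fintype.card G = p ^ N ∧ ∀ x : G, (p ^ N : ℤ) • x = 0 := by
  obtain ⟨N, hN⟩ := IsPGroup.iff_card.1 hG
  rw [Nat.card_congr Multiplicative.toAdd, Nat.card_eq_fintype_card] at hN
  refine ⟨N, hN, fun x => ?_⟩
  have hx : p ^ N • x = 0 := hN ▸ card_nsmul_eq_zero
  exact_mod_cast (natCast_zsmul x (p ^ N)).trans hx

theorem exists_addEquiv_pi_zmod {p : ℕ} [Fact p.Prime] {G : Type*} [AddCommGroup G] [Finite G]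
    (hG : IsPGroup p (Multiplicative G)) :
    ∃ (d : ℕ) (e : Fin d → ℕ), Nonempty (G ≃+ ((i : Fin d) → ZMod (p ^ e i))) := by
  have torsion : Module.IsTorsion' G (Submonoid.powers (p : ℤ)) := by
    refine (Submodule.isTorsion'_powers_iff (p : ℤ)).2 fun x => ?_
    obtain ⟨n, hn⟩ := isPGroup_iff_pow_pow_eq_one.1 hG (Multiplicative.ofAdd x)
    exact ⟨n, by exact_mod_cast (natCast_zsmul x (p ^ n)).trans hn⟩
  have irreducible : Irreducible (p : ℤ) := (Nat.prime_iff_prime_int.1 Fact.out).irreducible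
  obtain ⟨d, e, ⟨f⟩⟩ := Module.torsion_by_prime_power_decomposition irreducible torsion
  refine ⟨d, e, ⟨(f.toAddEquiv.trans (DirectSum.addEquivProd _)).trans
    (AddEquiv.piCongrRight fun i => ?_)⟩⟩
  exact ((Int.quotientSpanEquivZMod _).trans
    (ZMod.ringEquivCongr (by simp [Int.natAbs_pow]))).toAddEquiv

theorem sum_comp_eq_sum_card_filter_mul {ι : Type*} [Fintype ι] (e : ι → ℕ) (f : ℕ → ℕ)
    {s : Finset ℕ} (hs : ∀ i, e i ∈ s) :
    ∑ i, f (e i) = ∑ k ∈ s, (Finset.univ.filter fun i => e i = k).card * f k := by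
  rw [← Finset.sum_fiberwise_of_maps_to' fun i _ => hs i]
  simp_rw [Finset.sum_const, smul_eq_mul]

variable {G H : Type*} [AddCommGroup G] [AddCommGroup H]

theorem card_range_nsmul_eq [Finite G] [Finite H] (hG : IsPGroup 2 (Multiplicative G))
    (hH : IsPGroup 2 (Multiplicative H)) (h : ∀ k, homogeneousRank G k = homogeneousRank H k)
    (j : ℕ) : Nat.card (nsmulAddMonoidHom (α := G) (2 ^ j)).range =
      Nat.card (nsmulAddMonoidHom (α := H) (2 ^ j)).range := by
  obtain ⟨d, e, ⟨f⟩⟩ := exists_addEquiv_pi_zmod hG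
  obtain ⟨d', e', ⟨f'⟩⟩ := exists_addEquiv_pi_zmod hH
  rw [card_range_nsmul_pi e f, card_range_nsmul_pi e' f']
  congr 1
  let s := Finset.univ.image e ∪ Finset.univ.image e'
  rw [sum_comp_eq_sum_card_filter_mul e (· - j) (s := s) (by simp [s]),
    sum_comp_eq_sum_card_filter_mul e' (· - j) (s := s) (by simp [s])]
  refine Finset.sum_congr rfl fun k _ => ?_
  rcases k.eq_zero_or_pos with rfl | hk
  · simp
  · lift k to ℕ+ using hk
    rw [← homogeneousRank_eq_card e f, ← homogeneousRank_eq_card e' f', h]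

theorem card_eq_of_homogeneousRank_eq [Finite G] [Finite H] (hG : IsPGroup 2 (Multiplicative G))
    (hH : IsPGroup 2 (Multiplicative H)) (h : ∀ k, homogeneousRank G k = homogeneousRank H k) :
    Nat.card G = Nat.card H := by
  have hrange := card_range_nsmul_eq hG hH h 0
  rwa [AddMonoidHom.range_eq_top.2 fun x => ⟨x, by simp⟩,
    AddMonoidHom.range_eq_top.2 fun x => ⟨x, by simp⟩, AddSubgroup.card_top,
    AddSubgroup.card_top] at hrange

theorem card_ker_nsmul_eq [Finite G] [Finite H] (hG : IsPGroup 2 (Multiplicative G))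
    (hH : IsPGroup 2 (Multiplicative H)) (h : ∀ k, homogeneousRank G k = homogeneousRank H k)
    (j : ℕ) : Nat.card (nsmulAddMonoidHom (α := G) (2 ^ j)).ker =
      Nat.card (nsmulAddMonoidHom (α := H) (2 ^ j)).ker := by
  have hmul := card_eq_of_homogeneousRank_eq hG hH h
  rw [← AddSubgroup.card_mul_index (nsmulAddMonoidHom (α := G) (2 ^ j)).ker,
    ← AddSubgroup.card_mul_index (nsmulAddMonoidHom (α := H) (2 ^ j)).ker,
    AddSubgroup.index_ker, AddSubgroup.index_ker, card_range_nsmul_eq hG hH h] at hmul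
  exact Nat.eq_of_mul_eq_mul_right Nat.card_pos hmul

theorem homogeneousRank_prod [Finite G] [Finite H] (hG : IsPGroup 2 (Multiplicative G))
    (hH : IsPGroup 2 (Multiplicative H)) (k : ℕ+) :
    homogeneousRank (G × H) k = homogeneousRank G k + homogeneousRank H k := by
  obtain ⟨d, e, ⟨f⟩⟩ := exists_addEquiv_pi_zmod hG
  obtain ⟨d', e', ⟨f'⟩⟩ := exists_addEquiv_pi_zmod hH
  let F : G × H ≃+ ((i : Fin d ⊕ Fin d') → ZMod (2 ^ Sum.elim e e' i)) := (f.prodCongr f').trans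
    (LinearEquiv.sumPiEquivProdPi ℤ (Fin d) (Fin d')
      fun i => ZMod (2 ^ Sum.elim e e' i)).symm.toAddEquiv
  rw [homogeneousRank_eq_card _ F, homogeneousRank_eq_card e f, homogeneousRank_eq_card e' f',
    Finset.card_filter, Finset.card_filter, Finset.card_filter, Fintype.sum_sum_type]
  rfl

theorem homogeneousRank_congr [Finite G] (hG : IsPGroup 2 (Multiplicative G)) (e : G ≃+ H)
    (k : ℕ+) : homogeneousRank G k = homogeneousRank H k := by
  obtain ⟨d, n, ⟨f⟩⟩ := exists_addEquiv_pi_zmod hG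
  rw [homogeneousRank_eq_card n f, homogeneousRank_eq_card n (e.symm.trans f)]

end TwoGroup

theorem ExtendedZMod8.subFinite_untop_eq_iff {u v w : ExtendedZMod8} (hv : v ≠ ⊤) :
    subFinite u (v.untop hv) = w ↔ u = v + w := by
  lift v to ZMod 8 using hv
  rw [subFinite, WithTop.untop_coe]
  constructor
  · rintro rfl
    rw [add_left_comm, ← WithTop.coe_add, add_neg_cancel, WithTop.coe_zero, add_zero]
  · rintro rfl
    rw [add_right_comm, ← WithTop.coe_add, add_neg_cancel, WithTop.coe_zero, zero_add]

namespace LinkingPairing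

section Rank

variable {G H K : Type*} [AddCommGroup G] [AddCommGroup H] [AddCommGroup K]

theorem isPGroup_of_isomorphic_orthogonalSum {p : ℕ} {a : LinkingPairing G}
    {b : LinkingPairing H} {c : LinkingPairing K}
    (hG : IsPGroup p (Multiplicative G)) (h : a.Isomorphic (b.orthogonalSum c)) :
    IsPGroup p (Multiplicative K) := by
  obtain ⟨e, -⟩ := h
  exact hG.of_injective (AddMonoidHom.toMultiplicative
    ((e.symm : H × K →+ G).comp (AddMonoidHom.inr H K)))
    fun x y h => congrArg Prod.snd (e.symm.injective h)

theorem Isomorphic.rho_eq [Finite G] {a : LinkingPairing G} {b : LinkingPairing H}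
    (hG : IsPGroup 2 (Multiplicative G)) (h : a.Isomorphic b) (k : ℕ+) :
    a.rho k = b.rho k :=
  homogeneousRank_congr hG h.choose k

theorem rho_orthogonalSum [Finite G] [Finite H] (hG : IsPGroup 2 (Multiplicative G))
    (hH : IsPGroup 2 (Multiplicative H)) (a : LinkingPairing G) (b : LinkingPairing H) (k : ℕ+) :
    (a.orthogonalSum b).rho k = a.rho k + b.rho k :=
  homogeneousRank_prod hG hH k

end Rank

section Classification

variable {G H : Type*} [AddCommGroup G] [Fintype G] [AddCommGroup H] [Fintype H]
  {a : LinkingPairing G} {b : LinkingPairing H}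

theorem mem_differenceTableaux_iff {T : LinkingTableau} :
    T ∈ differenceTableaux a b ↔ ∀ k, (T k).1 = a.rho k - b.rho k ∧
      (b.sigma k ≠ ⊤ → a.sigma k = b.sigma k + (T k).2) := by
  constructor
  · rintro ⟨c, rfl⟩ k
    refine ⟨rfl, fun h => ?_⟩
    rw [differenceTableau, dif_neg h]
    exact (ExtendedZMod8.subFinite_untop_eq_iff h).1 rfl
  · intro h
    refine ⟨fun k => (T k).2, ?_⟩
    funext k
    refine Prod.ext (h k).1.symm ?_
    unfold differenceTableau
    split_ifs with hk
    · rfl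
    · exact (ExtendedZMod8.subFinite_untop_eq_iff hk).2 ((h k).2 hk)

theorem gaussSum_eq_charSum (a : LinkingPairing G) (k : ℕ+) :
    a.gaussSum k = charSum fun x => (2 ^ ((k : ℕ) - 1) : ℤ) • a.form x x :=
  Finset.sum_congr rfl fun x _ => gaussTerm_eq_circleChar k (a.form x x)

theorem conj_gaussSum_pow_four (hG : IsPGroup 2 (Multiplicative G)) (a : LinkingPairing G)
    (k : ℕ+) : conj (a.gaussSum k ^ 4) = a.gaussSum k ^ 4 := by
  obtain ⟨N, -, hN⟩ := exists_prime_pow_zsmul_eq_zero hG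
  rw [gaussSum_eq_charSum]
  exact conj_charSum_unary_pow_four a.symm hN _

theorem gaussSum_orthogonalSum (a : LinkingPairing G) (b : LinkingPairing H) (k : ℕ+) :
    (a.orthogonalSum b).gaussSum k = a.gaussSum k * b.gaussSum k := by
  simp only [gaussSum_eq_charSum, orthogonalSum_form, smul_add]
  exact charSum_prod (fun x => (2 ^ ((k : ℕ) - 1) : ℤ) • a.form x x)
    fun y => (2 ^ ((k : ℕ) - 1) : ℤ) • b.form y y

theorem sigma_orthogonalSum (hG : IsPGroup 2 (Multiplicative G))
    (hH : IsPGroup 2 (Multiplicative H)) (a : LinkingPairing G) (b : LinkingPairing H) (k : ℕ+) :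
    (a.orthogonalSum b).sigma k = a.sigma k + b.sigma k := by
  rw [sigma, gaussSum_orthogonalSum, eighthPhase_mul (a.conj_gaussSum_pow_four hG k)
    (b.conj_gaussSum_pow_four hH k), sigma, sigma]

theorem Isomorphic.sigma_eq (h : a.Isomorphic b) (k : ℕ+) : a.sigma k = b.sigma k := by
  obtain ⟨e, he⟩ := h
  rw [sigma, sigma, gaussSum_eq_charSum, gaussSum_eq_charSum,
    charSum_congr_equiv (q := fun y => (2 ^ ((k : ℕ) - 1) : ℤ) • b.form y y) e.toEquiv
      fun x => by simp [he]]

theorem gaussSum_eq_of_rho_eq_of_sigma_eq (hG : IsPGroup 2 (Multiplicative G))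
    (hH : IsPGroup 2 (Multiplicative H)) (hrho : ∀ k, a.rho k = b.rho k) {k : ℕ+}
    (hsigma : a.sigma k = b.sigma k) : a.gaussSum k = b.gaussSum k := by
  obtain ⟨M, -, hM⟩ := exists_prime_pow_zsmul_eq_zero hG
  obtain ⟨N, -, hN⟩ := exists_prime_pow_zsmul_eq_zero hH
  have hcard : Fintype.card G = Fintype.card H := by
    simpa using card_eq_of_homogeneousRank_eq hG hH hrho
  refine eq_of_eighthPhase_eq (a.conj_gaussSum_pow_four hG k) (b.conj_gaussSum_pow_four hH k)
    hsigma fun ha hb => ?_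
  rw [gaussSum_eq_charSum] at ha hb ⊢
  rw [gaussSum_eq_charSum]
  have hnorm_a := charSum_unary_mul_conj a.symm a.bijective_adjoint.1 hM _ ha
  have hnorm_b := charSum_unary_mul_conj b.symm b.bijective_adjoint.1 hN _ hb
  rw [hcard, card_ker_nsmul_eq hG hH hrho, ← hnorm_b, Complex.mul_conj', Complex.mul_conj']
    at hnorm_a
  exact (pow_left_inj₀ (norm_nonneg _) (norm_nonneg _) two_ne_zero).1 (by exact_mod_cast hnorm_a)

/-- The classification theorem of Kawauchi and Kojima. -/
theorem isomorphic_of_rho_eq_of_sigma_eq (hG : IsPGroup 2 (Multiplicative G))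
    (hH : IsPGroup 2 (Multiplicative H)) (hrho : ∀ k, a.rho k = b.rho k)
    (hsigma : ∀ k, a.sigma k = b.sigma k) : a.Isomorphic b := by
  have hker := card_ker_nsmul_eq hG hH hrho
  have hcard : Fintype.card G = Fintype.card H := by
    simpa using card_eq_of_homogeneousRank_eq hG hH hrho
  obtain ⟨N, hcardG, hNG⟩ := exists_prime_pow_zsmul_eq_zero hG
  have hNH (x : H) : (2 ^ N : ℤ) • x = 0 := by
    have hx : 2 ^ N • x = 0 := by rw [← hcardG, hcard, card_nsmul_eq_zero]
    exact_mod_cast (natCast_zsmul x (2 ^ N)).trans hx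
  have hunary (r : ℕ) : charSum (fun x => (2 ^ r : ℤ) • a.form x x) =
      charSum fun x => (2 ^ r : ℤ) • b.form x x := by
    simpa only [gaussSum_eq_charSum, Nat.succPNat_coe, Nat.succ_eq_add_one,
      Nat.add_sub_cancel] using
      gaussSum_eq_of_rho_eq_of_sigma_eq hG hH hrho (hsigma r.succPNat)
  refine exists_addEquiv_of_charSum_eq a.bijective_adjoint.1 b.bijective_adjoint.1 hcard
    fun n A => charSum_matForm_eq_of_isJordanBlock a.symm b.symm hNG hNH hcard ?_ A
  rintro m J (⟨r, hu⟩ | r | r)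
  · rw [charSum_matForm_fin_one, charSum_matForm_fin_one,
      charSum_unary_eq hNG hNH (hunary r) hu]
  · rw [charSum_hyperbolic a.bijective_adjoint.1, charSum_hyperbolic b.bijective_adjoint.1,
      hcard, hker]
  · exact charSum_anisotropic_eq a.symm b.symm a.bijective_adjoint.1 b.bijective_adjoint.1
      hNG hNH hcard (hker r)

theorem isOrthogonalSummand_iff (hG : IsPGroup 2 (Multiplicative G))
    (hH : IsPGroup 2 (Multiplicative H)) :
    b.IsOrthogonalSummand a ↔
      ∃ (K : Type) (_ : AddCommGroup K) (_ : Fintype K) (c : LinkingPairing K),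
        IsPGroup 2 (Multiplicative K) ∧
          ∀ k, a.rho k = b.rho k + c.rho k ∧ a.sigma k = b.sigma k + c.sigma k := by
  constructor
  · rintro ⟨K, instAdd, instFin, c, hiso⟩
    have hK := isPGroup_of_isomorphic_orthogonalSum hG hiso
    exact ⟨K, instAdd, instFin, c, hK, fun k =>
      ⟨(hiso.rho_eq hG k).trans (rho_orthogonalSum hH hK b c k),
        (hiso.sigma_eq k).trans (sigma_orthogonalSum hH hK b c k)⟩⟩
  · rintro ⟨K, instAdd, instFin, c, hK, hc⟩
    have hHK : IsPGroup 2 (Multiplicative (H × K)) :=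
      (isPGroup_prod hH hK).of_equiv (MulEquiv.prodMultiplicative H K).symm
    exact ⟨K, instAdd, instFin, c, isomorphic_of_rho_eq_of_sigma_eq hG hHK
      (fun k => (hc k).1.trans (rho_orthogonalSum hH hK b c k).symm)
      fun k => (hc k).2.trans (sigma_orthogonalSum hH hK b c k).symm⟩

end Classification

end LinkingPairing

theorem mainTheorem3 {G H : Type*} [AddCommGroup G] [Fintype G] [AddCommGroup H] [Fintype H]
    (hG : IsPGroup 2 (Multiplicative G)) (hH : IsPGroup 2 (Multiplicative H))
    (a : LinkingPairing G) (b : LinkingPairing H) :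
    b.IsOrthogonalSummand a ↔
      (∀ k : ℕ+, b.rho k ≤ a.rho k) ∧
      (∀ k : ℕ+, b.sigma k = ⊤ → a.sigma k = ⊤) ∧
      ∃ T ∈ differenceTableaux a b, T.IsAdmissible := by
  rw [LinkingPairing.isOrthogonalSummand_iff hG hH]
  constructor
  · rintro ⟨K, instAdd, instFin, c, hK, hc⟩
    have hmem : (fun k => (c.rho k, c.sigma k)) ∈ differenceTableaux a b :=
      LinkingPairing.mem_differenceTableaux_iff.2 fun k => ⟨by simp [hc], fun _ => (hc k).2⟩
    exact ⟨fun k => (hc k).1 ▸ Nat.le_add_right _ _,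
      fun k hk => by rw [(hc k).2, hk, WithTop.top_add],
      _, hmem, K, instAdd, instFin, c, hK, fun _ => rfl⟩
  · rintro ⟨hrho, htop, T, hT, K, instAdd, instFin, c, hK, hTc⟩
    refine ⟨K, instAdd, instFin, c, hK, fun k => ?_⟩
    obtain ⟨hrho_sub, hsigma⟩ := LinkingPairing.mem_differenceTableaux_iff.1 hT k
    rw [hTc] at hrho_sub hsigma
    refine ⟨(Nat.sub_eq_iff_eq_add' (hrho k)).1 hrho_sub.symm, ?_⟩
    by_cases hk : b.sigma k = ⊤
    · rw [htop k hk, hk, WithTop.top_add]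
    · exact hsigma hk
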